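/- Let $p$ be an odd prime, $\zeta_p$ a primitive $p$-th root of unity, $K=\mathbb Q(\zeta_p)$, $O=\mathbb Z[\zeta_p]$, $\pi=(\zeta_p-1)O$. Let $v$ be a primitive root mod $p$, let $\sigma$ be the automorphism of $K$ with $\sigma(\zeta_p)=\zeta_p^v$, and for $n\in\mathbb Z$ let $v_n\in\{1,\dots,p-1\}$ be the residue of $v^n$ mod $p$. Let $C_p=\Gamma_1\oplus\dots\oplus\Gamma_r$ be a decomposition of $C_p=\{c\in Cl(K): c^p=1\}$ into subgroups of order $p$, each annihilated by some $\sigma-\mu_i$ with $\mu_i\in\mathbb F_p^*$, and let $\Gamma$ be one of the $\Gamma_i$. Let $\mathbf q$ be a non-zero prime ideal of $O$ lying over a rational prime $q\neq p$, with $Cl(\mathbf q)\in\Gamma$. Put $m=N(\mathbf q)$ and $\mathbf F_m=O/\mathbf q$. Let $\zeta_q$ be a primitive $q$-th root of unity and define $$g(\mathbf q)=\sum_{x\in \mathbf F_m}\chi(x)\,\zeta_q^{\mathrm{Tr}_{\mathbf F_m/\mathbf F_q}(x)}\in\mathbb Z[\zeta_p,\zeta_q],$$ where $\chi(0)=0$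 and, for $\alpha\in O\setminus\mathbf q$, $\chi(\alpha \bmod \mathbf q)^{-1}$ is the $p$-th root of unity congruent to $\alpha^{(m-1)/p}$ mod $\mathbf q$. Extend $\sigma$ to $\mathbb Q(\zeta_p,\zeta_q)$ by $\sigma(\zeta_q)=\zeta_q$, and for $x\ne0$ and $F(X)=\sum_i a_iX^i\in\mathbb Z[X]$ write $x^{F(\sigma)}=\prod_i\sigma^i(x)^{a_i}$. Let $A\in O$ be such that $AO=\mathbf q^{2p}$, and suppose that $A$ is singular ($A$ is not a $p$-th power in $K$, and $AO$ is the $p$-th power of an ideal) and semi-primary ($A\equiv a \bmod \pi^2$ for some natural number $a$ prime to $p$). Let $\overline A$ be the complex conjugate of $A$. Then: 1. $g(\mathbf q)^{2p^2}=\pm A^{P(\sigma)}$, where $P(\sigma)=\sum_{i=0}^{p-2}v_{-i}\,\sigma^i$ is the Stickelberger element. 2. $g(\mathbf q)^{2p(\sigma-1)(\sigma-v)}=\pm\left(\overline A/A\right)^{Q_1(\sigma)}$, where $$Q_1(\sigma)=(1-\sigma)\sum_{i=0}^{(p-3)/2}\delta_i\,\sigma^i+(1-v)\,\sigma^{(p-1)/2},\qquad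 \delta_i=\frac{v_{-(i-1)}-v_{-i}\,v}{p}\in\mathbb Z .$$ -/

import Mathlib

open NumberField nonZeroDivisors Polynomial

noncomputable section

namespace GaussSingular

/-- `x ^ F(s)` for `F ∈ ℤ[X]` and an automorphism `s` of a field `M`: the action of the element
`F(s)` of the integral group ring of the group generated by `s`, that is
`∏ i, (s ^ i) (x) ^ (coefficient of X ^ i in F)`. -/
def polyExp {M : Type*} [Field M] (s : M ≃+* M) (F : ℤ[X]) (x : M) : M :=
  ∏ i ∈ F.support, ((s ^ i : M ≃+* M) x) ^ F.coeff i

/-- `v_n`: the representative in `{0, …, p - 1}` of `v ^ n mod p`, for `n ∈ ℤ`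
(it lies in `{1, …, p - 1}` when `p` does not divide `v`). -/
def vres (p : ℕ) [Fact p.Prime] (v : ℕ) (n : ℤ) : ℤ :=
  (((v : ZMod p) ^ n).val : ℤ)

/-- The Stickelberger polynomial `P(X) = ∑_{i=0}^{p-2} v_{-i} X^i`. -/
def stickP (p : ℕ) [Fact p.Prime] (v : ℕ) : ℤ[X] :=
  ∑ i ∈ Finset.range (p - 1), C (vres p v (-(i : ℤ))) * X ^ i

/-- `δ_i = (v_{-(i-1)} - v_{-i} v) / p`; the division by `p` is exact. -/
def delta (p : ℕ) [Fact p.Prime] (v : ℕ) (i : ℕ) : ℤ :=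
  (vres p v (-((i : ℤ) - 1)) - vres p v (-(i : ℤ)) * v) / p

/-- `Q₁(X) = (1 - X) ∑_{i=0}^{(p-3)/2} δ_i X^i + (1 - v) X^{(p-1)/2}`. -/
def polyQ₁ (p : ℕ) [Fact p.Prime] (v : ℕ) : ℤ[X] :=
  (1 - X) * (∑ i ∈ Finset.range ((p - 1) / 2), C (delta p v i) * X ^ i)
    + C (1 - (v : ℤ)) * X ^ ((p - 1) / 2)

section Field

variable {K : Type*} [Field K] [NumberField K]

/-- Complex conjugation on a `p`-cyclotomic field, `p > 2`. -/
def conjK (K : Type*) [Field K] [NumberField K] (p : ℕ) (hp : 2 < p)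
    [IsCyclotomicExtension {p} ℚ K] (x : K) : K :=
  haveI : IsCMField K := IsCyclotomicExtension.Rat.isCMField K (S := {p}) ⟨p, rfl, hp⟩
  IsCMField.complexConj K x

/-- `A` is singular: it is not a `p`-th power in `K`, and it generates the `p`-th power of an
ideal. -/
def IsSingular (p : ℕ) (A : 𝓞 K) : Prop :=
  (¬ ∃ x : K, x ^ p = (A : K)) ∧ ∃ I : Ideal (𝓞 K), Ideal.span {A} = I ^ p

/-- `A` is semi-primary: `A ≡ a mod π²` for a natural number `a` prime to `p`, where
`π = (ζ - 1)`. -/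
def IsSemiPrimary (p : ℕ) (ζ : 𝓞 K) (A : 𝓞 K) : Prop :=
  ∃ a : ℕ, a.Coprime p ∧ A - (a : 𝓞 K) ∈ (Ideal.span {ζ - 1}) ^ 2

/-- `Γ₁, …, Γ_r` is a decomposition of the `p`-class group of `K` (the subgroup of the classes
`c` with `c ^ p = 1`) as a direct sum of subgroups of order `p`, each of which is annihilated by
`s - μ` for some `μ ∈ 𝔽_p^*`. -/
structure IsPClassDecomposition (p : ℕ) (s : K ≃+* K) {r : ℕ}
    (Γ : Fin r → Subgroup (ClassGroup (𝓞 K))) : Prop where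
  card_eq : ∀ i, Nat.card (Γ i) = p
  annihilated : ∀ i, ∃ μ : (ZMod p)ˣ, ∀ I J : (Ideal (𝓞 K))⁰,
    (J : Ideal (𝓞 K)) = Ideal.map (RingOfIntegers.mapRingEquiv s) (I : Ideal (𝓞 K)) →
    ClassGroup.mk0 I ∈ Γ i → ClassGroup.mk0 J = ClassGroup.mk0 I ^ (μ : ZMod p).val
  independent : iSupIndep Γ
  iSup_eq : ⨆ i, Γ i = (powMonoidHom p : ClassGroup (𝓞 K) →* ClassGroup (𝓞 K)).ker

open Classical in
/-- The `p`-th power residue symbol modulo `𝔮`, as a function on the residue field: the `p`-th root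
of unity `β` with `β ≡ α ^ ((N𝔮 - 1) / p) mod 𝔮`; it is `0` on the class `0`, where there is no
such `β`. -/
def residueSymbol (p : ℕ) (𝔮 : Ideal (𝓞 K)) (x : 𝓞 K ⧸ 𝔮) : 𝓞 K :=
  if h : ∃ β : 𝓞 K, β ^ p = 1 ∧ Ideal.Quotient.mk 𝔮 β = x ^ ((Ideal.absNorm 𝔮 - 1) / p)
  then h.choose else 0

/-- The trace of the residue field `𝓞 K ⧸ 𝔮` over its prime field `𝔽_q`. -/
def residueTrace (𝔮 : Ideal (𝓞 K)) (q : ℕ) [CharP (𝓞 K ⧸ 𝔮) q] (x : 𝓞 K ⧸ 𝔮) : ZMod q :=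
  letI : Algebra (ZMod q) (𝓞 K ⧸ 𝔮) := ZMod.algebra (𝓞 K ⧸ 𝔮) q
  Algebra.trace (ZMod q) (𝓞 K ⧸ 𝔮) x

/-- The Gauss sum `g(𝔮) = ∑_{x ∈ 𝓞 K ⧸ 𝔮} χ(x) ξ ^ Tr(x)`, where `χ` is the inverse of the `p`-th
power residue symbol (`χ(0) = 0`) and `ξ` is a primitive `q`-th root of unity. -/
def gSum (p : ℕ) (𝔮 : Ideal (𝓞 K)) (q : ℕ) [CharP (𝓞 K ⧸ 𝔮) q]
    {L : Type*} [Field L] [Algebra K L] (ξ : L) : L :=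
  ∑ᶠ x : 𝓞 K ⧸ 𝔮,
    algebraMap K L ((residueSymbol p 𝔮 x : K)⁻¹) * ξ ^ (residueTrace 𝔮 q x).val

end Field

end GaussSingular

end

/-!
The heart of the matter is Stickelberger's factorization of the Gauss sum `g`, of which only one
inequality is needed. Let `γ = g ^ p`; it lies in `𝓞 K`, being `N(𝔮)` times a product of Jacobi
sums (`gaussSum_ringHomComp_pow`), and since Jacobi sums of characters of order `p` are `-1` modulo
`(ζ - 1) ^ 2`, it is semi-primary (`jacobiProduct_mem_semiPrimaryIntegers`).

Let `P` be a prime above `q` in a cyclotomic field that contains the roots of unity of orders `q`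
and `N(𝔮) - 1`, and let `ω` be the Teichmüller character of the residue field, which lifts its
elements to roots of unity. The Gauss sum of `ω⁻¹` has the same valuation as `ξ - 1`
(`valuation_sub_one_le_gaussSum`). Gauss sums are submultiplicative in the character, the defect
being a Jacobi sum, and invariant under Frobenius; hence the valuation of the Gauss sum of `ω ^ (-a)`
is at most the base-`q` digit sum of `a` times that of `ξ - 1` (`gaussSum_pow_dvd_pow_digits_sum`).
For the characters of order `p` this digit sum is `((q - 1) / p) ∑ (t q ^ j mod p)`
(`mul_digits_sum_eq`). On the other side, `q` is unramified, and the powers of `σ` that fix `𝔮` are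
those of the Frobenius `ζ ↦ ζ ^ q`, so that the same sum occurs in the valuation of `A ^ P(σ)`. It
follows that `A ^ P(σ) / γ ^ (2 p)` is an algebraic integer (`isIntegral_stickelberger_quotient`).

All its absolute values are `1`, because `γ γ̄ = N(𝔮) ^ p` and `(1 + σ ^ ((p - 1) / 2)) P(σ)` is `p`
times the norm (`norm_stickelberger_quotient`). By Kronecker's theorem it is a root of unity, and a
semi-primary root of unity is `±1`, as `ζ ^ k = 1 + k (ζ - 1)` modulo `(ζ - 1) ^ 2`. This is the first
assertion (`exists_gSum_pow_eq`).

For the second one, `(X - 1) (X - v) P(X) = p (X ^ ((p - 1) / 2) - 1) Q₁(X)` modulo `X ^ (p - 1) - 1`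
(`exists_stickP_eq`), and `σ ^ ((p - 1) / 2)` is complex conjugation. So the `p`-th powers of the two
sides agree; both sides are quotients of semi-primary integers, hence they are equal
(`polyExp_eq_conj_div`).
-/

namespace GaussSingular

/-! ### Powers with exponent in the group ring -/

/-- The `ℤ`-linear endomorphism of the multiplicative group of a field induced by an
automorphism; the multiplicative group is written additively. -/
def unitsEnd {M : Type*} [Field M] (s : M ≃+* M) : Module.End ℤ (Additive Mˣ) :=
  (Units.map (s : M →* M)).toAdditive.toIntLinearMap

theorem unitsEnd_pow_apply {M : Type*} [Field M] (s : M ≃+* M) (i : ℕ) (x : Mˣ) :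
    (((unitsEnd s ^ i) (Additive.ofMul x)).toMul : M) = (s ^ i : M ≃+* M) x := by
  induction i with
  | zero => simp
  | succ n ih =>
    rw [pow_succ', pow_succ', Module.End.mul_apply, RingAut.mul_apply, ← ih]
    rfl

theorem polyExp_units {M : Type*} [Field M] (s : M ≃+* M) (F : ℤ[X]) (x : Mˣ) :
    polyExp s F (x : M) = ((aeval (unitsEnd s) F (Additive.ofMul x)).toMul : M) := by
  rw [aeval_eq_sum_range, ← Polynomial.sum_over_range' F (f := fun i a => a • (unitsEnd s) ^ i)
    (by simp) _ (Nat.lt_succ_self _), Polynomial.sum, LinearMap.sum_apply, toMul_sum,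
    Units.coe_prod, polyExp]
  refine Finset.prod_congr rfl fun i _ => ?_
  rw [LinearMap.smul_apply, toMul_zsmul, Units.val_zpow_eq_zpow_val, unitsEnd_pow_apply]

section polyExp

variable {M : Type*} [Field M] (s : M ≃+* M)

theorem polyExp_ne_zero (F : ℤ[X]) {x : M} (hx : x ≠ 0) : polyExp s F x ≠ 0 := by
  lift x to Mˣ using IsUnit.mk0 _ hx
  rw [polyExp_units]; exact Units.ne_zero _

theorem polyExp_add (F G : ℤ[X]) {x : M} (hx : x ≠ 0) :
    polyExp s (F + G) x = polyExp s F x * polyExp s G x := by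
  lift x to Mˣ using IsUnit.mk0 _ hx
  simp [polyExp_units]

theorem polyExp_sub (F G : ℤ[X]) {x : M} (hx : x ≠ 0) :
    polyExp s (F - G) x = polyExp s F x / polyExp s G x := by
  lift x to Mˣ using IsUnit.mk0 _ hx
  simp [polyExp_units]

theorem polyExp_mul (F G : ℤ[X]) {x : M} (hx : x ≠ 0) :
    polyExp s (F * G) x = polyExp s F (polyExp s G x) := by
  lift x to Mˣ using IsUnit.mk0 _ hx
  simp [polyExp_units]

theorem polyExp_map_mul (F : ℤ[X]) (x y : M) :
    polyExp s F (x * y) = polyExp s F x * polyExp s F y := by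
  simp only [polyExp, map_mul, mul_zpow, Finset.prod_mul_distrib]

theorem polyExp_map_pow (F : ℤ[X]) (x : M) (n : ℕ) :
    polyExp s F (x ^ n) = polyExp s F x ^ n := by
  simp only [polyExp, map_pow, ← Finset.prod_pow]
  refine Finset.prod_congr rfl fun i _ => ?_
  rw [← zpow_natCast ((s ^ i : M ≃+* M) x) n, zpow_comm, zpow_natCast]

theorem polyExp_X_pow (n : ℕ) {x : M} (hx : x ≠ 0) :
    polyExp s (X ^ n) x = (s ^ n : M ≃+* M) x := by
  lift x to Mˣ using IsUnit.mk0 _ hx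
  rw [polyExp_units, map_pow, aeval_X, unitsEnd_pow_apply]

theorem polyExp_intCast (n : ℤ) {x : M} (hx : x ≠ 0) : polyExp s (n : ℤ[X]) x = x ^ n := by
  lift x to Mˣ using IsUnit.mk0 _ hx
  rw [polyExp_units, map_intCast, Module.End.intCast_apply, toMul_zsmul,
    Units.val_zpow_eq_zpow_val]
  rfl

theorem polyExp_natCast (n : ℕ) {x : M} (hx : x ≠ 0) : polyExp s (n : ℤ[X]) x = x ^ n := by
  have := polyExp_intCast s n hx
  simpa using this

theorem polyExp_one {x : M} (hx : x ≠ 0) : polyExp s 1 x = x := by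
  simpa using polyExp_natCast s 1 hx

theorem polyExp_X_sub_one {x : M} (hx : x ≠ 0) : polyExp s (X - 1) x = s x / x := by
  have h := polyExp_X_pow s 1 hx
  rw [polyExp_sub s _ _ hx, polyExp_one s hx]
  rw [pow_one, pow_one] at h
  rw [h]

theorem polyExp_one_right (F : ℤ[X]) : polyExp s F 1 = 1 := by
  simp [polyExp]

/-- A polynomial divisible by `X ^ n - 1` acts trivially when `s ^ n = 1`. -/
theorem polyExp_X_pow_sub_one_mul {n : ℕ} (hs : s ^ n = 1) (R : ℤ[X]) {x : M} (hx : x ≠ 0) :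
    polyExp s ((X ^ n - 1) * R) x = 1 := by
  have h := polyExp_ne_zero s R hx
  rw [polyExp_mul s _ _ hx, polyExp_sub s _ _ h, polyExp_X_pow s n h, polyExp_one s h, hs]
  exact div_self h

theorem polyExp_mem {S : Subgroup Mˣ} (hS : ∀ x : Mˣ, x ∈ S → Units.map (s : M →* M) x ∈ S)
    (F : ℤ[X]) {x : Mˣ} (hx : x ∈ S) {y : Mˣ} (hy : polyExp s F (x : M) = y) : y ∈ S := by
  have key : ∀ i : ℕ, ((unitsEnd s ^ i) (Additive.ofMul x)).toMul ∈ S := by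
    intro i
    induction i with
    | zero => simpa using hx
    | succ n ih => rw [pow_succ', Module.End.mul_apply]; exact hS _ ih
  have : y = ∏ i ∈ F.support, ((unitsEnd s ^ i) (Additive.ofMul x)).toMul ^ F.coeff i := by
    ext
    rw [← hy, polyExp, Units.coe_prod]
    refine Finset.prod_congr rfl fun i _ => ?_
    rw [Units.val_zpow_eq_zpow_val, unitsEnd_pow_apply]
  rw [this]
  exact S.prod_mem fun i _ => S.zpow_mem (key i) _

theorem polyExp_algebraMap {K L : Type*} [Field K] [Field L] [Algebra K L] (σ : K ≃+* K)
    (σL : L ≃+* L) (hσL : ∀ x : K, σL (algebraMap K L x) = algebraMap K L (σ x)) (F : ℤ[X])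
    (x : K) : polyExp σL F (algebraMap K L x) = algebraMap K L (polyExp σ F x) := by
  have key : ∀ i : ℕ, (σL ^ i : L ≃+* L) (algebraMap K L x) = algebraMap K L ((σ ^ i : K ≃+* K) x) := by
    intro i
    induction i with
    | zero => simp
    | succ n ih => rw [pow_succ', pow_succ', RingAut.mul_apply, RingAut.mul_apply, ih, hσL]
  simp [polyExp, key, map_prod]

end polyExp

/-! ### Identities of the Stickelberger polynomial -/

section Stickelberger

variable (p : ℕ) [Fact p.Prime] (v : ℕ)

theorem ne_zero_of_orderOf (hp : 2 < p) (hv : orderOf (v : ZMod p) = p - 1) :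
    (v : ZMod p) ≠ 0 := by
  intro h
  rw [h] at hv
  have : (0 : ZMod p) ^ (p - 1) = 1 := by rw [← hv]; exact pow_orderOf_eq_one _
  rw [zero_pow (by omega)] at this
  exact zero_ne_one this

theorem exists_pow_eq_of_orderOf (hp : 2 < p) (hv : orderOf (v : ZMod p) = p - 1) {x : ZMod p}
    (hx : x ≠ 0) : ∃ i < p - 1, (v : ZMod p) ^ i = x := by
  classical
  obtain ⟨i, hi, h⟩ := Finset.surj_on_of_inj_on_of_card_le (s := Finset.range (p - 1))
    (t := Finset.univ.erase (0 : ZMod p)) (fun i _ => (v : ZMod p) ^ i)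
    (fun i _ => Finset.mem_erase.mpr ⟨pow_ne_zero _ (ne_zero_of_orderOf p v hp hv),
      Finset.mem_univ _⟩)
    (fun i j hi hj h => pow_injOn_Iio_orderOf (by rw [hv]; exact Finset.mem_range.mp hi)
      (by rw [hv]; exact Finset.mem_range.mp hj) h)
    (by rw [Finset.card_erase_of_mem (Finset.mem_univ _), Finset.card_univ, ZMod.card,
      Finset.card_range])
    x (Finset.mem_erase.mpr ⟨hx, Finset.mem_univ _⟩)
  exact ⟨i, Finset.mem_range.mp hi, h.symm⟩

theorem intCast_vres (n : ℤ) : ((vres p v n : ℤ) : ZMod p) = (v : ZMod p) ^ n := by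
  simp [vres]

theorem mul_delta (hp : 2 < p) (hv : orderOf (v : ZMod p) = p - 1) (i : ℕ) :
    (p : ℤ) * delta p v i = vres p v (-((i : ℤ) - 1)) - vres p v (-(i : ℤ)) * v := by
  rw [delta]
  apply Int.mul_ediv_cancel'
  rw [← ZMod.intCast_zmod_eq_zero_iff_dvd]
  push_cast
  rw [intCast_vres, intCast_vres, neg_sub, sub_eq_add_neg 1, zpow_add₀ (ne_zero_of_orderOf p v hp hv)]
  simp [mul_comm]

theorem pow_half_eq_neg_one (hp : 2 < p) (hv : orderOf (v : ZMod p) = p - 1) :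
    (v : ZMod p) ^ ((p - 1) / 2) = -1 := by
  have hodd : p % 2 = 1 := (Fact.out : p.Prime).eq_two_or_odd.resolve_left (by omega)
  have h1 : ((v : ZMod p) ^ ((p - 1) / 2)) ^ 2 = 1 := by
    rw [← pow_mul, Nat.div_mul_cancel (by omega), ← hv, pow_orderOf_eq_one]
  rcases (sq_eq_sq_iff_eq_or_eq_neg.mp (h1.trans (one_pow 2).symm)) with h | h
  · exact absurd h (pow_ne_one_of_lt_orderOf (by omega) (by omega))
  · exact h

theorem vres_add_half (hp : 2 < p) (hv : orderOf (v : ZMod p) = p - 1) (n : ℤ) :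
    vres p v n + vres p v (n - ((p - 1) / 2 : ℕ)) = p := by
  have h0 := ne_zero_of_orderOf p v hp hv
  have hn : (v : ZMod p) ^ n ≠ 0 := zpow_ne_zero _ h0
  have : NeZero ((v : ZMod p) ^ n) := ⟨hn⟩
  rw [vres, vres, zpow_sub₀ h0, zpow_natCast, pow_half_eq_neg_one p v hp hv, div_neg, div_one,
    ZMod.val_neg_of_ne_zero]
  have := ((v : ZMod p) ^ n).val_lt
  omega

theorem delta_add_half (hp : 2 < p) (hv : orderOf (v : ZMod p) = p - 1) (i : ℕ) :
    delta p v i + delta p v (i + (p - 1) / 2) = 1 - v := by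
  have hp0 : (p : ℤ) ≠ 0 := by exact_mod_cast (by omega : p ≠ 0)
  apply mul_left_cancel₀ hp0
  rw [mul_add, mul_delta p v hp hv, mul_delta p v hp hv]
  have h1 := vres_add_half p v hp hv (-((i : ℤ) - 1))
  have h2 := vres_add_half p v hp hv (-(i : ℤ))
  have e1 : -(((i + (p - 1) / 2 : ℕ) : ℤ) - 1) = -((i : ℤ) - 1) - ((p - 1) / 2 : ℕ) := by
    push_cast; ring
  have e2 : -(((i + (p - 1) / 2 : ℕ) : ℤ)) = -(i : ℤ) - ((p - 1) / 2 : ℕ) := by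
    push_cast; ring
  rw [e1, e2]
  linear_combination h1 - v * h2

/-- `(X - v) P(X) ≡ p ∑ δ_i X ^ i` modulo `X ^ (p - 1) - 1`. -/
theorem X_sub_mul_stickP (hp : 2 < p) (hv : orderOf (v : ZMod p) = p - 1) :
    (X - (v : ℤ[X])) * stickP p v
      = (p : ℤ[X]) * (∑ i ∈ Finset.range (p - 1), C (delta p v i) * X ^ i)
        + (X ^ (p - 1) - 1) * C (vres p v 1) := by
  obtain ⟨n, hn⟩ : ∃ n, p - 1 = n + 1 := ⟨p - 2, by omega⟩
  have hd : ∀ i, (p : ℤ[X]) * (C (delta p v i) * X ^ i) = C (vres p v (-((i : ℤ) - 1))) * X ^ i -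
      (v : ℤ[X]) * (C (vres p v (-(i : ℤ))) * X ^ i) := by
    intro i
    have := congrArg (C : ℤ → ℤ[X]) (mul_delta p v hp hv i)
    simp only [map_mul, map_sub, map_natCast] at this
    rw [← mul_assoc, this]; ring
  have hsum : X * ∑ i ∈ Finset.range (p - 1), C (vres p v (-(i : ℤ))) * X ^ i =
      (∑ i ∈ Finset.range (p - 1), C (vres p v (-((i : ℤ) - 1))) * X ^ i) +
      (X ^ (p - 1) - 1) * C (vres p v 1) := by
    have hlast : vres p v (-(n : ℤ)) = vres p v 1 := by
      have h0 := ne_zero_of_orderOf p v hp hv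
      rw [vres, vres]
      congr 2
      have : (v : ZMod p) ^ (n + 1) = 1 := by rw [← hn, ← hv, pow_orderOf_eq_one]
      rw [zpow_neg, zpow_natCast, zpow_one]
      exact inv_eq_of_mul_eq_one_right (by rw [← this, pow_succ])
    rw [hn, Finset.sum_range_succ, Finset.sum_range_succ', hlast, mul_add, Finset.mul_sum]
    have : ∀ i : ℕ, X * (C (vres p v (-(i : ℤ))) * X ^ i) =
        C (vres p v (-(((i + 1 : ℕ) : ℤ) - 1))) * X ^ (i + 1) := by
      intro i
      rw [show -(((i + 1 : ℕ) : ℤ) - 1) = -(i : ℤ) by push_cast; ring]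
      ring
    simp only [this]
    rw [show -(((0 : ℕ) : ℤ) - 1) = 1 by norm_num]
    ring
  rw [stickP, sub_mul, hsum, Finset.mul_sum, Finset.mul_sum, Finset.sum_congr rfl fun i _ => hd i,
    Finset.sum_sub_distrib]
  ring

/-- `(X - 1) ∑ δ_i X ^ i = (X ^ ((p - 1) / 2) - 1) Q₁(X)`, because
`δ_i + δ_{i + (p - 1) / 2} = 1 - v`. -/
theorem X_sub_one_mul_sum_delta (hp : 2 < p) (hv : orderOf (v : ZMod p) = p - 1) :
    (X - 1) * (∑ i ∈ Finset.range (p - 1), C (delta p v i) * X ^ i)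
      = (X ^ ((p - 1) / 2) - 1) * polyQ₁ p v := by
  have hodd : p % 2 = 1 := (Fact.out : p.Prime).eq_two_or_odd.resolve_left (by omega)
  have h2 : p - 1 = (p - 1) / 2 + (p - 1) / 2 := by omega
  set h := (p - 1) / 2 with hh
  have hd : ∀ i, C (delta p v (h + i)) * X ^ (h + i) =
      X ^ h * (C (1 - (v : ℤ)) * X ^ i - C (delta p v i) * X ^ i) := by
    intro i
    rw [← delta_add_half p v hp hv i, ← hh, add_comm i h, C_add]; ring
  have hg : (∑ i ∈ Finset.range h, (X : ℤ[X]) ^ i) * (X - 1) = X ^ h - 1 := geom_sum_mul X h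
  rw [polyQ₁, ← hh, h2, Finset.sum_range_add]
  simp only [hd]
  rw [← Finset.mul_sum, Finset.sum_sub_distrib, ← Finset.mul_sum]
  linear_combination X ^ h * C (1 - (v : ℤ)) * hg

theorem exists_stickP_eq (hp : 2 < p) (hv : orderOf (v : ZMod p) = p - 1) :
    ∃ R : ℤ[X], (X - 1) * (X - (v : ℤ[X])) * stickP p v =
      (p : ℤ[X]) * (polyQ₁ p v * (X ^ ((p - 1) / 2) - 1)) + (X ^ (p - 1) - 1) * R := by
  refine ⟨(X - 1) * C (vres p v 1), ?_⟩
  have h1 := X_sub_mul_stickP p v hp hv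
  have h2 := X_sub_one_mul_sum_delta p v hp hv
  linear_combination (X - 1) * h1 + (p : ℤ[X]) * h2

/-- `(1 + X ^ ((p - 1) / 2)) P(X) ≡ p ∑ X ^ i` modulo `X ^ (p - 1) - 1`. -/
theorem exists_stickP_add_half (hp : 2 < p) (hv : orderOf (v : ZMod p) = p - 1) :
    ∃ R : ℤ[X], (1 + X ^ ((p - 1) / 2)) * stickP p v =
      (p : ℤ[X]) * (∑ i ∈ Finset.range (p - 1), X ^ i) + (X ^ (p - 1) - 1) * R := by
  have hodd : p % 2 = 1 := (Fact.out : p.Prime).eq_two_or_odd.resolve_left (by omega)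
  have h2 : p - 1 = (p - 1) / 2 + (p - 1) / 2 := by omega
  set h := (p - 1) / 2 with hh
  refine ⟨∑ i ∈ Finset.range h, C (vres p v (-((h + i : ℕ) : ℤ))) * X ^ i, ?_⟩
  have hd : ∀ i : ℕ, C (vres p v (-(i : ℤ))) * X ^ i =
      (p : ℤ[X]) * X ^ i - C (vres p v (-((h + i : ℕ) : ℤ))) * X ^ i := by
    intro i
    have := congrArg (C : ℤ → ℤ[X]) (vres_add_half p v hp hv (-(i : ℤ)))
    rw [← hh, show -(i : ℤ) - (h : ℕ) = -((h + i : ℕ) : ℤ) by push_cast; ring] at this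
    simp only [map_add, map_natCast] at this
    linear_combination X ^ i * this
  have hx : ∀ i, (X : ℤ[X]) ^ (h + i) = X ^ h * X ^ i := fun i => pow_add _ _ _
  rw [stickP, h2, Finset.sum_range_add, Finset.sum_range_add]
  simp only [hx, mul_left_comm _ (X ^ h)]
  rw [Finset.sum_congr rfl fun i _ => hd i, Finset.sum_sub_distrib, ← Finset.mul_sum,
    ← Finset.mul_sum, ← Finset.mul_sum]
  ring

end Stickelberger

/-! ### Sums of digits -/

section Digits

theorem mul_pow_sub_mod_eq {q f a i : ℕ} (hq : 1 < q) (ha : a < q ^ f - 1) (hi : i < f) :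
    a * q ^ (f - i) % (q ^ f - 1) + (q ^ f - 1) * (a / q ^ i) = a * q ^ (f - i) := by
  obtain ⟨k, rfl⟩ : ∃ k, f = i + k := ⟨f - i, by omega⟩
  rw [Nat.add_sub_cancel_left]
  have hB : 0 < q ^ i := by positivity
  have hC : 0 < q ^ k := by positivity
  rw [pow_add] at ha ⊢
  generalize q ^ i = B at *
  generalize q ^ k = N at *
  set u := a / B
  set w := a % B
  have hau : a = B * u + w := (Nat.div_add_mod a B).symm
  have hw : w < B := Nat.mod_lt _ hB
  have hBN : 1 ≤ B * N := Nat.mul_pos hB hC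
  obtain ⟨D, hD⟩ : ∃ D, B * N = D + 1 := ⟨B * N - 1, by omega⟩
  rw [hD, Nat.add_sub_cancel] at ha ⊢
  have hu : u < N := by
    by_contra h
    have : B * N ≤ B * u := Nat.mul_le_mul_left _ (not_lt.mp h)
    omega
  have key : a * N = (u + w * N) + D * u := by
    have : B * N * u = (D + 1) * u := by rw [hD]
    rw [hau]
    linarith
  -- the rotated digit string is not the string of all digits `q - 1`
  have hlt : u + w * N < D := by
    have h1 : (w + 1) * N ≤ B * N := Nat.mul_le_mul_right _ hw
    have h2 : w * N + N ≤ D + 1 := by linarith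
    rcases Nat.lt_or_ge (u + 1) N with h | h
    · omega
    · rcases Nat.lt_or_ge (w + 1) B with h' | h'
      · have h3 : (w + 2) * N ≤ B * N := Nat.mul_le_mul_right _ h'
        have h4 : w * N + N + N ≤ D + 1 := by linarith
        omega
      · have hu' : N = u + 1 := by omega
        have hw' : B = w + 1 := by omega
        exfalso
        rw [hu', hw'] at hD
        rw [hau, hw'] at ha
        have : (w + 1) * (u + 1) = (w + 1) * u + w + 1 := by ring
        omega
  rw [key, Nat.add_mul_mod_self_left, Nat.mod_eq_of_lt hlt]

theorem digits_sum_eq {q : ℕ} (hq : 1 < q) (a : ℕ) :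
    (Nat.digits q a).sum = a % q + (Nat.digits q (a / q)).sum := by
  rcases Nat.eq_zero_or_pos a with rfl | ha
  · simp
  · rw [Nat.digits_def' hq ha, List.sum_cons]

theorem sub_one_mul_sum_div_add_digits_sum {q : ℕ} (hq : 1 < q) (f : ℕ) :
    ∀ a < q ^ f, (q - 1) * ∑ i ∈ Finset.range f, a / q ^ (i + 1) + (Nat.digits q a).sum = a := by
  induction f with
  | zero => intro a ha; obtain rfl : a = 0 := by simpa using ha
            simp
  | succ f ih =>
    intro a ha
    have hb : a / q < q ^ f := Nat.div_lt_of_lt_mul (by rwa [pow_succ'] at ha)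
    have h := ih _ hb
    have e : ∀ i, a / q ^ (i + 1 + 1) = a / q / q ^ (i + 1) := by
      intro i; rw [Nat.div_div_eq_div_mul, ← pow_succ']
    rw [Finset.sum_range_succ', digits_sum_eq hq]
    simp only [e]
    have hm := Nat.div_add_mod a q
    obtain ⟨r, rfl⟩ : ∃ r, q = r + 1 := ⟨q - 1, by omega⟩
    simp only [Nat.add_sub_cancel, zero_add, pow_one] at h ⊢
    rw [mul_add]
    linarith

/-- The sum of the base-`q` digits of `a < q ^ f - 1` in terms of the residues of the `a q ^ j`
modulo `q ^ f - 1`. -/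
theorem mul_digits_sum_eq {q f a : ℕ} (hq : 1 < q) (ha : a < q ^ f - 1) :
    (q ^ f - 1) * (Nat.digits q a).sum =
      (q - 1) * ∑ j ∈ Finset.range f, a * q ^ j % (q ^ f - 1) := by
  have hf : f ≠ 0 := by rintro rfl; simp at ha
  -- modulo `q ^ f - 1` the exponents `0, …, f - 1` may be replaced by `f, …, 1`
  have hrot : ∑ j ∈ Finset.range f, a * q ^ j % (q ^ f - 1) =
      ∑ i ∈ Finset.range f, a * q ^ (f - i) % (q ^ f - 1) := by
    obtain ⟨g, rfl⟩ := Nat.exists_eq_succ_of_ne_zero hf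
    rw [← Finset.sum_range_reflect (fun j => a * q ^ j % (q ^ (g + 1) - 1)),
      Finset.sum_range_succ, Finset.sum_range_succ', add_comm]
    have h1 : ∀ i ∈ Finset.range g, g + 1 - 1 - i = g + 1 - (i + 1) := by intros; omega
    rw [add_comm, Finset.sum_congr rfl fun i hi => by rw [h1 i hi]]
    congr 1
    have : a * q ^ (g + 1) = a + (q ^ (g + 1) - 1) * a := by
      have : 1 ≤ q ^ (g + 1) := Nat.one_le_pow _ _ (by omega)
      obtain ⟨D, hD⟩ : ∃ D, q ^ (g + 1) = D + 1 := ⟨q ^ (g + 1) - 1, by omega⟩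
      rw [hD, Nat.add_sub_cancel]; ring
    rw [Nat.sub_zero, this, Nat.add_mul_mod_self_left, Nat.succ_sub_one, Nat.sub_self, pow_zero,
      mul_one]
  have hsum := Finset.sum_congr rfl fun i (hi : i ∈ Finset.range f) =>
    mul_pow_sub_mod_eq hq ha (Finset.mem_range.mp hi)
  rw [Finset.sum_add_distrib, ← hrot, ← Finset.mul_sum, ← Finset.mul_sum] at hsum
  have hgeom : (q - 1) * ∑ i ∈ Finset.range f, q ^ (f - i) = q * (q ^ f - 1) := by
    have h : ∀ g, (q - 1) * ∑ i ∈ Finset.range g, q ^ (g - i) + q = q * q ^ g := by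
      intro g
      induction g with
      | zero => simp
      | succ g ih =>
        have e : ∀ i ∈ Finset.range g, q ^ (g + 1 - (i + 1)) = q ^ (g - i) := by
          intro i _; congr 1; omega
        rw [Finset.sum_range_succ', Finset.sum_congr rfl e, mul_add, add_right_comm, ih]
        obtain ⟨r, rfl⟩ : ∃ r, q = r + 1 := ⟨q - 1, by omega⟩
        simp only [Nat.add_sub_cancel, Nat.sub_zero]
        ring
    have := h f
    rw [Nat.mul_sub]
    omega
  have hleg := sub_one_mul_sum_div_add_digits_sum hq f a (by omega)
  have hdiv : ∑ i ∈ Finset.range f, a / q ^ i = a + ∑ i ∈ Finset.range f, a / q ^ (i + 1) := by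
    have h1 := Finset.sum_range_succ (fun i => a / q ^ i) f
    have h2 := Finset.sum_range_succ' (fun i => a / q ^ i) f
    have h3 : a / q ^ f = 0 := Nat.div_eq_of_lt (by omega)
    simp only [pow_zero, Nat.div_one] at h2
    omega
  rw [hdiv] at hsum
  obtain ⟨D, hD⟩ : ∃ D, q ^ f = D + 1 := ⟨q ^ f - 1, by omega⟩
  rw [hD, Nat.add_sub_cancel] at hsum hgeom ⊢
  obtain ⟨r, rfl⟩ : ∃ r, q = r + 1 := ⟨q - 1, by omega⟩
  rw [Nat.add_sub_cancel] at hgeom hleg ⊢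
  have h1 := congrArg (r * ·) hsum
  have h2 := congrArg (a * ·) hgeom
  have h3 := congrArg (D * ·) hleg
  linarith

end Digits

/-! ### Characters and Gauss sums of finite fields -/

section Characters

variable {F R : Type*} [Field F] [Fintype F] [CommRing R]

/-- Gauss sums are invariant under the Frobenius of the finite field. -/
theorem gaussSum_pow_char (q : ℕ) [Fact q.Prime] [CharP F q] (χ : MulChar F R) (ψ : AddChar F R)
    (hψ : ∀ x, ψ (x ^ q) = ψ x) : gaussSum (χ ^ q) ψ = gaussSum χ ψ := by
  have hb : Function.Bijective (frobenius F q) :=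
    Finite.injective_iff_bijective.mp (frobenius_inj F q)
  rw [gaussSum, gaussSum, ← hb.sum_comp (fun x => χ x * ψ x)]
  refine Finset.sum_congr rfl fun x _ => ?_
  rw [frobenius_def, hψ, MulChar.pow_apply' _ (Fact.out : q.Prime).ne_zero, map_pow]

/-- A lift `ω` of the identity of `F` is injective, so that its powers are nontrivial. -/
theorem pow_ne_one_of_lift {P : Ideal R} [P.IsPrime] {θ : F →+* R ⧸ P}
    {ω : MulChar F R} (hω : ∀ x : F, x ≠ 0 → Ideal.Quotient.mk P (ω x) = θ x)
    {a : ℕ} (ha : 0 < a) (ha' : a < Fintype.card F - 1) : ω ^ a ≠ 1 := by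
  intro h
  obtain ⟨g, hg⟩ := IsCyclic.exists_generator (α := Fˣ)
  have h1 : ω (g : F) ^ a = 1 := by
    rw [← MulChar.pow_apply_coe, h, MulChar.one_apply_coe]
  have h2 := congrArg (Ideal.Quotient.mk P) h1
  rw [map_pow, hω _ g.ne_zero, ← map_pow, map_one, map_eq_one_iff θ θ.injective] at h2
  have h3 : g ^ a = 1 := by ext; simpa using h2
  have h4 := orderOf_dvd_of_pow_eq_one h3
  classical
  rw [orderOf_eq_card_of_forall_mem_zpowers hg, Nat.card_eq_fintype_card, Fintype.card_units] at h4
  exact absurd (Nat.le_of_dvd ha h4) (by omega)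

variable [IsDomain R]

/-- Roots of unity lift through a prime ideal: if `R` contains a primitive `n`-th root of unity,
with `n ∣ #F - 1`, and `F` maps to `R ⧸ P`, then `x ↦ x ^ ((#F - 1) / n)` lifts to a multiplicative
character with values in the `n`-th roots of unity of `R`. -/
theorem exists_mulChar_lift (P : Ideal R) [P.IsPrime] (θ : F →+* R ⧸ P) {n : ℕ} (hn : 0 < n)
    (hdvd : n ∣ Fintype.card F - 1) {η : R} (hη : IsPrimitiveRoot η n) :
    ∃ χ : MulChar F R, χ ^ n = 1 ∧
      ∀ x : F, x ≠ 0 → Ideal.Quotient.mk P (χ x) = θ x ^ ((Fintype.card F - 1) / n) := by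
  classical
  obtain ⟨g, hg⟩ := IsCyclic.exists_generator (α := Fˣ)
  set c := (Fintype.card F - 1) / n with hc
  have hcn : c * n = Fintype.card F - 1 := Nat.div_mul_cancel hdvd
  have hy : (θ g ^ c) ^ n = 1 := by
    rw [← pow_mul, hcn, ← map_pow, FiniteField.pow_card_sub_one_eq_one _ g.ne_zero, map_one]
  obtain ⟨ζ, hζn, hζ⟩ : ∃ ζ : R, ζ ^ n = 1 ∧ Ideal.Quotient.mk P ζ = θ g ^ c := by
    have h := congrArg (Polynomial.eval₂ (Ideal.Quotient.mk P) (θ g ^ c))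
      (X_pow_sub_one_eq_prod hn hη)
    rw [Polynomial.eval₂_sub, Polynomial.eval₂_one, Polynomial.eval₂_X_pow, hy, sub_self,
      Polynomial.eval₂_finsetProd, eq_comm, Finset.prod_eq_zero_iff] at h
    obtain ⟨ζ, hζ, h⟩ := h
    rw [Polynomial.eval₂_sub, Polynomial.eval₂_X, Polynomial.eval₂_C, sub_eq_zero] at h
    exact ⟨ζ, (mem_nthRootsFinset hn _).mp hζ, h.symm⟩
  let ζu : Rˣ := Units.ofPowEqOne ζ n hζn hn.ne'
  have hroot : ζu ∈ rootsOfUnity (Fintype.card Fˣ) R := by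
    rw [mem_rootsOfUnity]
    ext
    rw [Fintype.card_units, ← hcn, mul_comm, pow_mul]
    simp [ζu]
  have hspec : MulChar.ofRootOfUnity hroot hg (g : F) = ζ := by
    rw [MulChar.ofRootOfUnity_spec]; rfl
  refine ⟨MulChar.ofRootOfUnity hroot hg, ?_, ?_⟩
  · rw [MulChar.eq_iff hg, MulChar.pow_apply_coe, hspec, hζn, MulChar.one_apply_coe]
  · intro x hx
    obtain ⟨k, hk⟩ := mem_powers_iff_mem_zpowers.mpr (hg (Units.mk0 x hx))
    have hxk : x = (g : F) ^ k := by
      have := congrArg Units.val hk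
      simpa using this.symm
    rw [hxk, map_pow, map_pow, hspec, hζ, map_pow, ← pow_mul, ← pow_mul, mul_comm]

theorem eq_of_mk_eq_of_pow_eq_one (P : Ideal R) {p : ℕ} (hp : (p : R) ∉ P) {a b : R}
    (ha : a ^ p = 1) (hb : b ^ p = 1) (h : Ideal.Quotient.mk P a = Ideal.Quotient.mk P b) :
    a = b := by
  have hp0 : p ≠ 0 := by rintro rfl; simp at hp
  -- `c = a / b`
  set c := a * b ^ (p - 1) with hc
  have hbb : b ^ (p - 1) * b = 1 := by rw [← pow_succ, Nat.sub_one_add_one hp0, hb]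
  have hcp : c ^ p = 1 := by rw [hc, mul_pow, ha, ← pow_mul, mul_comm, mul_comm (p - 1), pow_mul, hb]; simp
  have hmc : Ideal.Quotient.mk P c = 1 := by
    rw [hc, map_mul, h, ← map_mul, mul_comm, hbb, map_one]
  have hgeom : (∑ i ∈ Finset.range p, c ^ i) * (c - 1) = 0 := by
    rw [geom_sum_mul, hcp, sub_self]
  rcases mul_eq_zero.mp hgeom with h0 | h0
  · exfalso
    apply hp
    have := congrArg (Ideal.Quotient.mk P) h0
    simp only [map_sum, map_pow, hmc, one_pow, Finset.sum_const, Finset.card_range, nsmul_eq_mul,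
      mul_one, map_zero] at this
    rw [← Ideal.Quotient.eq_zero_iff_mem, map_natCast, this]
  · have : c = 1 := sub_eq_zero.mp h0
    calc a = a * (b ^ (p - 1) * b) := by rw [hbb, mul_one]
      _ = c * b := by rw [hc]; ring
      _ = b := by rw [this, one_mul]

/-- The Gauss sum of `χ ^ (a + b)` divides the product of those of `χ ^ a` and `χ ^ b`, the
quotient being a Jacobi sum. -/
theorem gaussSum_pow_add_dvd {χ : MulChar F R} {a b : ℕ} (h : χ ^ (a + b) ≠ 1)
    (ψ : AddChar F R) : gaussSum (χ ^ (a + b)) ψ ∣ gaussSum (χ ^ a) ψ * gaussSum (χ ^ b) ψ := by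
  rw [pow_add] at h ⊢
  exact ⟨_, (jacobiSum_mul_nontrivial h ψ).symm⟩

/-- The Gauss sum of `χ ^ a` divides the power of that of `χ` whose exponent is the sum of the
base-`q` digits of `a`. -/
theorem gaussSum_pow_dvd_pow_digits_sum (q : ℕ) [Fact q.Prime] [CharP F q] (χ : MulChar F R)
    (ψ : AddChar F R) (hψ : ∀ x, ψ (x ^ q) = ψ x) (hψ0 : ψ ≠ 1) (a : ℕ) :
    (∀ b, 0 < b → b ≤ a → χ ^ b ≠ 1) →
    gaussSum (χ ^ a) ψ ∣ gaussSum χ ψ ^ (Nat.digits q a).sum := by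
  have hq : 1 < q := (Fact.out : q.Prime).one_lt
  induction a using Nat.strong_induction_on with
  | _ a ih =>
  intro hne
  rcases Nat.eq_zero_or_pos a with rfl | ha
  · rw [pow_zero, gaussSum_one_left hψ0]
    simp
  rcases Nat.eq_zero_or_pos (a % q) with h0 | h0
  · have haq : a = a / q * q := by rw [Nat.div_mul_cancel (Nat.dvd_of_mod_eq_zero h0)]
    have hlt : a / q < a := Nat.div_lt_self ha hq
    have := ih _ hlt fun b hb hb' => hne b hb (hb'.trans hlt.le)
    rw [digits_sum_eq hq, h0, zero_add]
    rwa [← gaussSum_pow_char q _ _ hψ, ← pow_mul, ← haq] at this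
  · obtain ⟨b, rfl⟩ : ∃ b, a = b + 1 := ⟨a - 1, by omega⟩
    have h1 := ih b (by omega) fun c hc hc' => hne c hc (by omega)
    have hdig : (Nat.digits q (b + 1)).sum = (Nat.digits q b).sum + 1 := by
      rw [digits_sum_eq hq, digits_sum_eq hq b]
      have h2 : (b + 1) / q = b / q := by
        rw [Nat.succ_div_of_not_dvd]
        intro h; exact h0.ne' (Nat.mod_eq_zero_of_dvd h)
      have h3 := Nat.div_add_mod (b + 1) q
      have h4 := Nat.div_add_mod b q
      rw [h2] at h3 ⊢
      omega
    rw [hdig, pow_succ (gaussSum χ ψ)]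
    have h2 := gaussSum_pow_add_dvd (hne (b + 1) (by omega) le_rfl) ψ
    rw [pow_one] at h2
    exact h2.trans (mul_dvd_mul_right h1 _)

/-- With `λ = ξ - 1`, the Gauss sum of a character `χ` is congruent modulo `λ ^ 2` to
`λ ∑ χ(x) Tr(x)`. -/
theorem gaussSum_eq_mul_sub_one {χ : MulChar F R} (hχ : χ ≠ 1) {ξ : R} {ψ : AddChar F R}
    (t : F → ℕ) (hψ : ∀ x, ψ x = ξ ^ t x) :
    ∃ z, gaussSum χ ψ = (ξ - 1) * ((∑ x, χ x * (t x : R)) + z * (ξ - 1)) := by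
  have key : ∀ n : ℕ, ∃ z : R, ξ ^ n = 1 + (ξ - 1) * (n + z * (ξ - 1)) := by
    intro n
    induction n with
    | zero => exact ⟨0, by simp⟩
    | succ n ih =>
      obtain ⟨z, hz⟩ := ih
      refine ⟨z * ξ + n, ?_⟩
      rw [pow_succ, hz]; push_cast; ring
  choose z hz using key
  refine ⟨∑ x, χ x * z (t x), ?_⟩
  have h0 := MulChar.sum_eq_zero_of_ne_one hχ
  rw [gaussSum, Finset.sum_mul, ← Finset.sum_add_distrib, Finset.mul_sum, ← sub_zero (∑ i, _),
    ← h0, ← Finset.sum_sub_distrib]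
  refine Finset.sum_congr rfl fun x _ => ?_
  rw [hψ, hz]; ring

/-- `∑ x⁻¹ Tr(x) = -1`: only the first term of `Tr(x) = x + x ^ q + ⋯` contributes. -/
theorem sum_inv_mul_trace {F : Type*} [Field F] [Fintype F] (q : ℕ) [Fact q.Prime]
    [Algebra (ZMod q) F] :
    ∑ x : F, x⁻¹ * algebraMap (ZMod q) F (Algebra.trace (ZMod q) F x) = -1 := by
  classical
  have hq : 1 < q := (Fact.out : q.Prime).one_lt
  set f := Module.finrank (ZMod q) F with hf
  have hcard : Fintype.card F = q ^ f := by
    rw [Module.card_eq_pow_finrank (K := ZMod q), ZMod.card]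
  have hf0 : 0 < f := Module.finrank_pos
  simp_rw [FiniteField.algebraMap_trace_eq_sum_pow, Nat.card_zmod, Finset.mul_sum]
  rw [Finset.sum_comm, ← hf]
  obtain ⟨g, hg⟩ : ∃ g, f = g + 1 := ⟨f - 1, by omega⟩
  rw [hg, Finset.sum_range_succ', Finset.sum_eq_zero, zero_add]
  · simp only [pow_zero, pow_one]
    rw [← Finset.add_sum_erase _ _ (Finset.mem_univ (0 : F)), mul_zero, zero_add,
      Finset.sum_congr rfl fun x hx => inv_mul_cancel₀ (Finset.ne_of_mem_erase hx),
      Finset.sum_const, Finset.card_erase_of_mem (Finset.mem_univ _), Finset.card_univ,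
      nsmul_eq_mul, mul_one, Nat.cast_sub Fintype.card_pos, Nat.cast_card_eq_zero]
    simp
  · intro i hi
    have hi' : i + 1 < f := by rw [hg]; simpa using hi
    have h1 : 1 < q ^ (i + 1) := Nat.one_lt_pow (by omega) hq
    rw [← FiniteField.sum_pow_lt_card_sub_one F (q ^ (i + 1) - 1)]
    · refine Finset.sum_congr rfl fun x _ => ?_
      rcases eq_or_ne x 0 with rfl | hx
      · rw [zero_pow (by omega), zero_pow (by omega), mul_zero]
      · rw [inv_mul_eq_iff_eq_mul₀ hx, ← pow_succ', Nat.sub_one_add_one (by omega)]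
    · rw [hcard]
      have := Nat.pow_lt_pow_right hq hi'
      omega

theorem trace_pow_char {F : Type*} [Field F] [Fintype F] (q : ℕ) [Fact q.Prime]
    [Algebra (ZMod q) F] (x : F) :
    Algebra.trace (ZMod q) F (x ^ q) = Algebra.trace (ZMod q) F x := by
  have h := Algebra.trace_eq_of_algEquiv (FiniteField.frobeniusAlgEquivOfAlgebraic (ZMod q) F) x
  rwa [FiniteField.coe_frobeniusAlgEquivOfAlgebraic, ZMod.card] at h

section Valuation

variable {Γ₀ : Type*} [LinearOrderedCommGroupWithZero Γ₀] {w : Valuation R Γ₀}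
  {P : Ideal R} [P.IsPrime] {q : ℕ} [Fact q.Prime] [Algebra (ZMod q) F]
  {θ : F →+* R ⧸ P} {ω : MulChar F R} {ξ : R} {ψ : AddChar F R}

/-- The Gauss sum of the inverse Teichmüller character is exactly divisible by `ξ - 1`. -/
theorem valuation_sub_one_le_gaussSum (hw : ∀ x, w x ≤ 1) (hP : ∀ x, w x < 1 ↔ x ∈ P)
    (hω : ∀ x : F, x ≠ 0 → Ideal.Quotient.mk P (ω x) = θ x) (hcard : 2 < Fintype.card F)
    (hξ : ξ ^ q = 1) (hψ : ∀ x, ψ x = ξ ^ (Algebra.trace (ZMod q) F x).val) :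
    w (ξ - 1) ≤ w (gaussSum ω⁻¹ ψ) := by
  have : NeZero q := ⟨(Fact.out : q.Prime).ne_zero⟩
  have : CharP F q := charP_of_injective_algebraMap (algebraMap (ZMod q) F).injective q
  have : CharP (R ⧸ P) q := charP_of_injective_ringHom θ.injective q
  have hω1 : ω⁻¹ ≠ 1 := by
    have := pow_ne_one_of_lift hω one_pos (by omega)
    rw [pow_one] at this
    rwa [Ne, inv_eq_one]
  have hξP : Ideal.Quotient.mk P (ξ - 1) = 0 := by
    rw [← pow_eq_zero_iff (n := q) (Fact.out : q.Prime).ne_zero, map_sub, map_one, sub_pow_char,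
      ← map_pow, hξ, map_one, one_pow, sub_self]
  obtain ⟨z, hz⟩ := gaussSum_eq_mul_sub_one hω1 _ hψ
  set S := ∑ x, ω⁻¹ x * ((Algebra.trace (ZMod q) F x).val : R) with hS
  have hmk : Ideal.Quotient.mk P (S + z * (ξ - 1)) = -1 := by
    rw [map_add, map_mul, hξP, mul_zero, add_zero, hS, map_sum, ← map_one θ, ← map_neg,
      ← sum_inv_mul_trace q, map_sum]
    refine Finset.sum_congr rfl fun x _ => ?_
    rcases eq_or_ne x 0 with rfl | hx
    · simp
    · rw [map_mul, map_mul, map_natCast, MulChar.inv_apply', hω _ (inv_ne_zero hx)]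
      congr 1
      conv_rhs => rw [← ZMod.natCast_zmod_val (Algebra.trace (ZMod q) F x)]
      rw [map_natCast, map_natCast]
  have h1 : w (S + z * (ξ - 1)) = 1 := by
    refine le_antisymm (hw _) (not_lt.mp fun h => ?_)
    rw [hP, ← Ideal.Quotient.eq_zero_iff_mem, hmk, neg_eq_zero] at h
    exact one_ne_zero h
  rw [hz, map_mul, h1, mul_one]

/-- The upper bound in Stickelberger's theorem, for the power `t (m - 1) / p` of the inverse
Teichmüller character of a field with `m = q ^ f` elements. -/
theorem valuation_pow_le_gaussSum_pow (hw : ∀ x, w x ≤ 1) (hP : ∀ x, w x < 1 ↔ x ∈ P)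
    (hω : ∀ x : F, x ≠ 0 → Ideal.Quotient.mk P (ω x) = θ x)
    {f : ℕ} (hf : Fintype.card F = q ^ f) {p c : ℕ} (hp : 1 < p) (hc : c * p = Fintype.card F - 1)
    (hξ : IsPrimitiveRoot ξ q) (hψ : ∀ x, ψ x = ξ ^ (Algebra.trace (ZMod q) F x).val)
    (hψ1 : ψ ≠ 1) {t : ℕ} (ht : t < p) :
    w (q : R) ^ (∑ j ∈ Finset.range f, t * q ^ j % p) ≤ w (gaussSum (ω⁻¹ ^ (c * t)) ψ) ^ p := by
  have hq : 1 < q := (Fact.out : q.Prime).one_lt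
  have : CharP F q := charP_of_injective_algebraMap (algebraMap (ZMod q) F).injective q
  have hm : 1 < Fintype.card F := Fintype.one_lt_card
  have hc0 : 0 < c := by
    rcases Nat.eq_zero_or_pos c with rfl | h
    · omega
    · exact h
  have hat : c * t < Fintype.card F - 1 := by rw [← hc]; exact Nat.mul_lt_mul_of_pos_left ht hc0
  have hm2 : 2 < Fintype.card F := by
    have : 1 * p ≤ c * p := Nat.mul_le_mul_right _ hc0
    omega
  have hψF : ∀ x, ψ (x ^ q) = ψ x := fun x => by rw [hψ, hψ, trace_pow_char]
  -- the digit bound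
  have hdvd := gaussSum_pow_dvd_pow_digits_sum q ω⁻¹ ψ hψF hψ1 (c * t) fun b hb hb' => by
    rw [inv_pow, Ne, inv_eq_one]
    exact pow_ne_one_of_lift hω hb (by omega)
  have mono : ∀ {x y : R}, x ∣ y → w y ≤ w x := by
    rintro x _ ⟨y, rfl⟩
    rw [map_mul]
    exact mul_le_of_le_one_right' (hw y)
  have h1 : w (ξ - 1) ^ (Nat.digits q (c * t)).sum ≤ w (gaussSum (ω⁻¹ ^ (c * t)) ψ) := by
    refine (pow_le_pow_left' (valuation_sub_one_le_gaussSum hw hP hω hm2 hξ.pow_eq_one hψ) _).trans ?_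
    rw [← map_pow]
    exact mono hdvd
  -- `(ξ - 1) ^ (q - 1)` divides `q`
  have h2 : w (q : R) ≤ w (ξ - 1) ^ (q - 1) := by
    rw [← map_pow]
    apply mono
    obtain ⟨r, hr⟩ : ∃ r, q = r + 1 := ⟨q - 1, by omega⟩
    rw [hr] at hξ
    rw [hr, Nat.add_sub_cancel, Nat.cast_add, Nat.cast_one, ← hξ.prod_one_sub_pow_eq_order]
    nth_rewrite 1 [← Finset.card_range r]
    rw [← Finset.prod_const]
    refine Finset.prod_dvd_prod_of_dvd _ _ fun i _ => ?_
    rw [← neg_sub (ξ ^ (i + 1)), dvd_neg]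
    exact sub_one_dvd_pow_sub_one ξ _
  have hT : ∀ j, c * t * q ^ j % (q ^ f - 1) = c * (t * q ^ j % p) := by
    intro j
    rw [← hf, ← hc, mul_assoc, Nat.mul_mod_mul_left]
  have h3 := mul_digits_sum_eq (f := f) hq (hf ▸ hat)
  simp only [hT] at h3
  rw [← Finset.mul_sum, ← hf, ← hc] at h3
  have h4 : p * (Nat.digits q (c * t)).sum = (q - 1) * ∑ j ∈ Finset.range f, t * q ^ j % p := by
    apply Nat.eq_of_mul_eq_mul_left hc0
    linarith
  calc w (q : R) ^ (∑ j ∈ Finset.range f, t * q ^ j % p)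
      ≤ (w (ξ - 1) ^ (q - 1)) ^ (∑ j ∈ Finset.range f, t * q ^ j % p) := pow_le_pow_left' h2 _
    _ = (w (ξ - 1) ^ (Nat.digits q (c * t)).sum) ^ p := by
      rw [← pow_mul, ← pow_mul, ← h4, mul_comm]
    _ ≤ _ := pow_le_pow_left' h1 _

end Valuation

end Characters

/-! ### Arithmetic of the cyclotomic field -/

section Cyclotomic

variable {p : ℕ} [Fact p.Prime] {K : Type*} [Field K] [NumberField K]
  [IsCyclotomicExtension {p} ℚ K] {ζ : 𝓞 K}

theorem ringHom_ext_of_zeta (hζ : IsPrimitiveRoot ζ p) {S : Type*} [Ring S] {f g : 𝓞 K →+* S}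
    (h : f ζ = g ζ) : f = g := by
  have hζK : IsPrimitiveRoot (ζ : K) p := hζ.map_of_injective RingOfIntegers.coe_injective
  have htop := IsCyclotomicExtension.Rat.adjoin_singleton_eq_top hζK
  have h1 : f.toIntAlgHom = g.toIntAlgHom := by
    refine AlgHom.ext_of_adjoin_eq_top htop ?_
    rintro x rfl
    exact h
  ext x
  exact AlgHom.congr_fun h1 x

section Automorphism

variable {v : ℕ} {σ : K ≃+* K}

theorem map_zeta_pow (hσ : σ (ζ : K) = (ζ : K) ^ v) (l : ℕ) :
    (σ ^ l : K ≃+* K) (ζ : K) = (ζ : K) ^ v ^ l := by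
  induction l with
  | zero => simp
  | succ l ih => rw [pow_succ', RingAut.mul_apply, ih, map_pow, hσ, ← pow_mul, pow_succ']

theorem mapRingEquiv_zeta (hσ : σ (ζ : K) = (ζ : K) ^ v) (l : ℕ) :
    RingOfIntegers.mapRingEquiv (σ ^ l) ζ = ζ ^ v ^ l := by
  apply RingOfIntegers.coe_injective
  simp only [map_pow]
  exact map_zeta_pow hσ l

theorem ringEquiv_ext_of_zeta (hζ : IsPrimitiveRoot ζ p) {σ τ : K ≃+* K}
    (h : σ (ζ : K) = τ (ζ : K)) : σ = τ := by
  have h1 := ringHom_ext_of_zeta hζ (f := (σ : K →+* K).comp (algebraMap (𝓞 K) K))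
    (g := (τ : K →+* K).comp (algebraMap (𝓞 K) K)) h
  have h2 := IsLocalization.ringHom_ext (nonZeroDivisors (𝓞 K)) h1
  ext x
  exact RingHom.congr_fun h2 x

theorem zeta_pow_eq_of_zmod_eq (hζ : IsPrimitiveRoot ζ p) {a b : ℕ}
    (h : (a : ZMod p) = b) : ζ ^ a = ζ ^ b := by
  rw [ZMod.natCast_eq_natCast_iff] at h
  exact (hζ.isOfFinOrder (Fact.out : p.Prime).ne_zero).pow_eq_pow_iff_modEq.mpr
    (hζ.eq_orderOf ▸ h)

theorem automorphism_pow_eq_pow (hζ : IsPrimitiveRoot ζ p) (hσ : σ (ζ : K) = (ζ : K) ^ v)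
    {i j : ℕ} (h : (v : ZMod p) ^ i = (v : ZMod p) ^ j) : σ ^ i = σ ^ j := by
  apply ringEquiv_ext_of_zeta hζ
  rw [map_zeta_pow hσ, map_zeta_pow hσ]
  have : ζ ^ v ^ i = ζ ^ v ^ j := zeta_pow_eq_of_zmod_eq hζ (by push_cast; exact h)
  have := congrArg (algebraMap (𝓞 K) K) this
  simpa using this

theorem automorphism_pow_eq_one (hζ : IsPrimitiveRoot ζ p)
    (hv : orderOf (v : ZMod p) = p - 1) (hσ : σ (ζ : K) = (ζ : K) ^ v) : σ ^ (p - 1) = 1 := by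
  rw [← pow_zero σ]
  exact automorphism_pow_eq_pow hζ hσ (by rw [← hv, pow_orderOf_eq_one, pow_zero])

theorem conjK_eq (hζ : IsPrimitiveRoot ζ p) (hp : 2 < p)
    (hv : orderOf (v : ZMod p) = p - 1) (hσ : σ (ζ : K) = (ζ : K) ^ v) (x : K) :
    conjK K p hp x = (σ ^ ((p - 1) / 2) : K ≃+* K) x := by
  have : IsCMField K := IsCyclotomicExtension.Rat.isCMField K (S := {p}) ⟨p, rfl, hp⟩
  have h : ((IsCMField.complexConj K : K ≃ₐ[maximalRealSubfield K] K) : K ≃+* K) =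
      σ ^ ((p - 1) / 2) := by
    apply ringEquiv_ext_of_zeta hζ
    have h1 : (ζ : K) ^ v ^ ((p - 1) / 2) * ζ = 1 := by
      have : ζ ^ (v ^ ((p - 1) / 2) + 1) = ζ ^ 0 := zeta_pow_eq_of_zmod_eq hζ (by
        push_cast; rw [pow_half_eq_neg_one p v hp hv, neg_add_cancel])
      have := congrArg (algebraMap (𝓞 K) K) this
      simpa [pow_succ] using this
    have hζ1 : (ζ : K) ^ p = 1 := by
      have := congrArg (algebraMap (𝓞 K) K) hζ.pow_eq_one
      simpa using this
    rw [map_zeta_pow hσ]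
    let φ : K →+* ℂ := Classical.arbitrary _
    apply φ.injective
    have h2 : φ (IsCMField.complexConj K (ζ : K)) = (φ (ζ : K))⁻¹ := by
      rw [IsCMField.complexEmbedding_complexConj, ← Complex.inv_eq_conj]
      exact Complex.norm_eq_one_of_pow_eq_one (n := p) (by rw [← map_pow, hζ1, map_one])
        (Fact.out : p.Prime).ne_zero
    have h3 := congrArg φ h1
    rw [map_mul, map_one] at h3
    exact h2.trans (eq_inv_of_mul_eq_one_left h3).symm
  rw [← h]; rfl

theorem prod_automorphisms (hζ : IsPrimitiveRoot ζ p)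
    (hv : orderOf (v : ZMod p) = p - 1) (hσ : σ (ζ : K) = (ζ : K) ^ v) (x : K) :
    ∏ i ∈ Finset.range (p - 1), (σ ^ i : K ≃+* K) x = algebraMap ℚ K (Algebra.norm ℚ x) := by
  classical
  have hζK : IsPrimitiveRoot (ζ : K) p := hζ.map_of_injective RingOfIntegers.coe_injective
  have : IsGalois ℚ K := IsCyclotomicExtension.isGalois {p} ℚ K
  rw [Algebra.norm_eq_prod_automorphisms]
  let τ : ℕ → (K ≃ₐ[ℚ] K) := fun i => AlgEquiv.ofRingEquiv (f := σ ^ i) (fun r => by simp)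
  have hcard : Fintype.card (K ≃ₐ[ℚ] K) = p - 1 := by
    rw [← Nat.card_eq_fintype_card, IsGalois.card_aut_eq_finrank,
      IsCyclotomicExtension.finrank K (Polynomial.cyclotomic.irreducible_rat
        (Fact.out : p.Prime).pos), Nat.totient_prime Fact.out]
  have hinj : ∀ i ∈ Finset.range (p - 1), ∀ j ∈ Finset.range (p - 1), τ i = τ j → i = j := by
    intro i hi j hj h
    have h1 : (σ ^ i : K ≃+* K) (ζ : K) = (σ ^ j : K ≃+* K) (ζ : K) := AlgEquiv.congr_fun h (ζ : K)
    rw [map_zeta_pow hσ, map_zeta_pow hσ, (hζK.isOfFinOrder (Fact.out : p.Prime).ne_zero).pow_eq_pow_iff_modEq,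
      ← hζK.eq_orderOf, ← ZMod.natCast_eq_natCast_iff, Nat.cast_pow, Nat.cast_pow] at h1
    exact pow_injOn_Iio_orderOf (by rw [hv]; exact Finset.mem_range.mp hi)
      (by rw [hv]; exact Finset.mem_range.mp hj) h1
  refine Finset.prod_bij (fun i _ => τ i) (fun _ _ => Finset.mem_univ _)
    (fun i hi j hj h => hinj i hi j hj h) ?_ (fun _ _ => rfl)
  intro g _
  obtain ⟨i, hi, h⟩ := Finset.surj_on_of_inj_on_of_card_le (s := Finset.range (p - 1))
    (fun i _ => τ i) (fun _ _ => Finset.mem_univ _)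
    (fun i j hi hj h => hinj i hi j hj h) (by rw [Finset.card_univ, hcard, Finset.card_range])
    g (Finset.mem_univ _)
  exact ⟨i, hi, h.symm⟩

/-- The Frobenius congruence: if `v ^ l ≡ q ^ j` modulo `p`, then `σ ^ l (x) ≡ x ^ (q ^ j)` modulo
every ideal with residue ring of characteristic `q`. -/
theorem mk_automorphism_pow (hζ : IsPrimitiveRoot ζ p) (hσ : σ (ζ : K) = (ζ : K) ^ v)
    {q : ℕ} [Fact q.Prime] (I : Ideal (𝓞 K)) [CharP (𝓞 K ⧸ I) q] {l j : ℕ}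
    (h : (v : ZMod p) ^ l = (q : ZMod p) ^ j) (x : 𝓞 K) :
    Ideal.Quotient.mk I (RingOfIntegers.mapRingEquiv (σ ^ l) x) =
      Ideal.Quotient.mk I x ^ q ^ j := by
  have h1 := ringHom_ext_of_zeta hζ
    (f := (Ideal.Quotient.mk I).comp (RingOfIntegers.mapRingEquiv (σ ^ l) : 𝓞 K →+* 𝓞 K))
    (g := (iterateFrobenius (𝓞 K ⧸ I) q j).comp (Ideal.Quotient.mk I)) (by
      simp only [RingHom.comp_apply, iterateFrobenius_def, RingHom.coe_coe]
      rw [mapRingEquiv_zeta hσ, ← map_pow]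
      congr 1
      exact zeta_pow_eq_of_zmod_eq hζ (by push_cast; exact h))
  exact RingHom.congr_fun h1 x

end Automorphism

section Residue

variable {q : ℕ} [Fact q.Prime] {𝔮 : Ideal (𝓞 K)} [CharP (𝓞 K ⧸ 𝔮) q]

theorem natCast_mem_of_charP : (q : 𝓞 K) ∈ 𝔮 := by
  rw [← Ideal.Quotient.eq_zero_iff_mem, map_natCast, CharP.cast_eq_zero]

theorem natCast_notMem_of_ne (hqp : q ≠ p) : (p : 𝓞 K) ∉ 𝔮 := by
  intro h
  rw [← Ideal.Quotient.eq_zero_iff_mem, map_natCast, CharP.cast_eq_zero_iff (𝓞 K ⧸ 𝔮) q] at h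
  exact hqp ((Nat.prime_dvd_prime_iff_eq Fact.out Fact.out).mp h)

theorem zmod_ne_zero_of_ne (hqp : q ≠ p) : (q : ZMod p) ≠ 0 := by
  intro h
  rw [ZMod.natCast_eq_zero_iff] at h
  exact hqp ((Nat.prime_dvd_prime_iff_eq Fact.out Fact.out).mp h).symm

/-- The residue ring of any ideal of residue characteristic `q ≠ p` satisfies `x ^ (q ^ f) = x`,
where `f` is the order of `q` modulo `p`. -/
theorem mk_pow_pow_orderOf (hζ : IsPrimitiveRoot ζ p) (x : 𝓞 K) :
    Ideal.Quotient.mk 𝔮 x ^ q ^ orderOf (q : ZMod p) = Ideal.Quotient.mk 𝔮 x := by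
  have h := mk_automorphism_pow (v := 1) (σ := 1) hζ (by simp) 𝔮 (l := 0)
    (j := orderOf (q : ZMod p)) (by rw [pow_orderOf_eq_one, pow_zero]) x
  rw [← h]
  congr 1

variable [𝔮.IsPrime]

/-- The residue field at a prime above `q` has `q ^ f` elements, `f` the order of `q`
modulo `p`. -/
theorem absNorm_eq_pow_orderOf (hζ : IsPrimitiveRoot ζ p) (hqp : q ≠ p) (h𝔮 : 𝔮 ≠ ⊥) :
    Ideal.absNorm 𝔮 = q ^ orderOf (q : ZMod p) ∧ p ∣ Ideal.absNorm 𝔮 - 1 := by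
  have : 𝔮.IsMaximal := Ideal.IsPrime.isMaximal inferInstance h𝔮
  let _ : Field (𝓞 K ⧸ 𝔮) := Ideal.Quotient.field 𝔮
  have : Finite (𝓞 K ⧸ 𝔮) := Ideal.finiteQuotientOfFreeOfNeBot 𝔮 h𝔮
  let _ : Fintype (𝓞 K ⧸ 𝔮) := Fintype.ofFinite _
  have hcard : Ideal.absNorm 𝔮 = Fintype.card (𝓞 K ⧸ 𝔮) := by
    rw [Ideal.absNorm_apply, Submodule.cardQuot_apply, Nat.card_eq_fintype_card]
  have hq : 1 < q := (Fact.out : q.Prime).one_lt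
  set f := orderOf (q : ZMod p) with hf
  have hf0 : 0 < f := by
    rw [hf, orderOf_pos_iff]
    exact isOfFinOrder_iff_isUnit.mpr (zmod_ne_zero_of_ne hqp).isUnit
  -- `ζ` generates a subgroup of order `p` of the units of the residue field
  have hdvd : p ∣ Ideal.absNorm 𝔮 - 1 := by
    have h1 : Ideal.Quotient.mk 𝔮 ζ ^ p = 1 := by rw [← map_pow, hζ.pow_eq_one, map_one]
    have h2 : orderOf (Ideal.Quotient.mk 𝔮 ζ) = p := by
      refine orderOf_eq_prime h1 fun h => ?_
      have := eq_of_mk_eq_of_pow_eq_one 𝔮 (natCast_notMem_of_ne (q := q) hqp) hζ.pow_eq_one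
        (one_pow p) (by rw [h, map_one])
      exact hζ.ne_one (Fact.out : p.Prime).one_lt this
    rw [hcard, ← h2]
    refine orderOf_dvd_of_pow_eq_one (FiniteField.pow_card_sub_one_eq_one _ fun h => ?_)
    rw [h, zero_pow (Fact.out : p.Prime).ne_zero] at h1
    exact zero_ne_one h1
  refine ⟨?_, hdvd⟩
  rw [hcard] at hdvd ⊢
  obtain ⟨⟨n, hn0⟩, _, hn⟩ := FiniteField.card (𝓞 K ⧸ 𝔮) q
  have hle : Fintype.card (𝓞 K ⧸ 𝔮) ≤ q ^ f := by
    have hne : (X ^ q ^ f - X : (𝓞 K ⧸ 𝔮)[X]) ≠ 0 :=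
      FiniteField.X_pow_card_pow_sub_X_ne_zero _ hf0.ne' hq
    have h1 := Polynomial.card_roots' (X ^ q ^ f - X : (𝓞 K ⧸ 𝔮)[X])
    rw [FiniteField.X_pow_card_pow_sub_X_natDegree_eq _ hf0.ne' hq] at h1
    refine le_trans ?_ h1
    classical
    rw [← Finset.card_univ]
    refine (Finset.card_le_card fun x _ => ?_).trans (Multiset.toFinset_card_le _)
    obtain ⟨y, rfl⟩ := Ideal.Quotient.mk_surjective x
    rw [Multiset.mem_toFinset, Polynomial.mem_roots hne, Polynomial.IsRoot]
    rw [Polynomial.eval_sub, Polynomial.eval_pow, Polynomial.eval_X]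
    rw [mk_pow_pow_orderOf hζ, sub_self]
  have hfn : f ∣ n := by
    rw [hf, orderOf_dvd_iff_pow_eq_one, ← Nat.cast_pow, ← Nat.cast_one, eq_comm,
      ZMod.natCast_eq_natCast_iff]
    exact (Nat.modEq_iff_dvd' (Nat.one_le_pow _ _ (by omega))).mpr (hn ▸ hdvd)
  refine le_antisymm hle ?_
  rw [hn]
  exact Nat.pow_le_pow_right (by omega) (Nat.le_of_dvd hn0 hfn)

/-- `q` is unramified: a generator `A` of `𝔮 ^ n` is locally equal to `q ^ n`. -/
theorem exists_mul_eq_pow_mul (hζ : IsPrimitiveRoot ζ p) (hqp : q ≠ p) (h𝔮 : 𝔮 ≠ ⊥) {A : 𝓞 K}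
    {n : ℕ} (hA : Ideal.span {A} = 𝔮 ^ n) : ∃ b ∉ 𝔮, ∃ c, A * b = (q : 𝓞 K) ^ n * c := by
  have hq : 1 < q := (Fact.out : q.Prime).one_lt
  obtain ⟨𝔟, h𝔟⟩ : 𝔮 ∣ Ideal.span {(q : 𝓞 K)} := by
    rw [Ideal.dvd_span_singleton]; exact natCast_mem_of_charP
  have hnle : ¬ 𝔟 ≤ 𝔮 := by
    intro hle
    -- otherwise `x - x ^ (q ^ f) ∈ (q) ⊆ 𝔮 ^ 2` shows that `𝔮 = 𝔮 ^ 2`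
    have hq2 : Ideal.span {(q : 𝓞 K)} ≤ 𝔮 ^ 2 := by
      rw [h𝔟, sq]; exact Ideal.mul_mono_right hle
    have hnu : (q : 𝓞 K) ∈ nonunits (𝓞 K) := fun hu =>
      (inferInstance : 𝔮.IsPrime).ne_top (Ideal.eq_top_of_isUnit_mem _ natCast_mem_of_charP hu)
    have : CharP (𝓞 K ⧸ Ideal.span {(q : 𝓞 K)}) q := CharP.quotient (𝓞 K) q hnu
    have hf : 1 < q ^ orderOf (q : ZMod p) := Nat.one_lt_pow (by
      rw [← pos_iff_ne_zero, orderOf_pos_iff]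
      exact isOfFinOrder_iff_isUnit.mpr (zmod_ne_zero_of_ne hqp).isUnit) hq
    have h2 : 𝔮 ≤ 𝔮 ^ 2 := by
      intro x hx
      have h3 := mk_pow_pow_orderOf (𝔮 := Ideal.span {(q : 𝓞 K)}) hζ x
      rw [← map_pow, Ideal.Quotient.mk_eq_mk_iff_sub_mem] at h3
      have h4 : x ^ q ^ orderOf (q : ZMod p) ∈ 𝔮 ^ 2 :=
        Ideal.pow_le_pow_right hf (Ideal.pow_mem_pow hx _)
      simpa using sub_mem h4 (hq2 h3)
    have h5 : 𝔮 ^ 2 < 𝔮 ^ 1 := Ideal.pow_right_strictAnti 𝔮 h𝔮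
      (inferInstance : 𝔮.IsPrime).ne_top one_lt_two
    rw [pow_one] at h5
    exact absurd h2 (not_le_of_gt h5)
  obtain ⟨b, hb, hb'⟩ := SetLike.not_le_iff_exists.mp hnle
  refine ⟨b ^ n, fun h => hb' (Ideal.IsPrime.mem_of_pow_mem inferInstance n h), ?_⟩
  have : A * b ^ n ∈ Ideal.span {(q : 𝓞 K) ^ n} := by
    rw [← Ideal.span_singleton_pow, h𝔟, mul_pow, ← hA]
    exact Ideal.mul_mem_mul (Ideal.mem_span_singleton_self A) (Ideal.pow_mem_pow hb n)
  obtain ⟨c, hc⟩ := Ideal.mem_span_singleton.mp this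
  exact ⟨c, hc⟩

end Residue

end Cyclotomic

/-! ### Semi-primary numbers -/

section SemiPrimary

variable {p : ℕ} {K : Type*} [Field K]

/-- The multiplicative monoid of the integers of `K` that are congruent modulo `(ζ - 1) ^ 2` to a
rational integer prime to `p`. -/
def semiPrimaryIntegers (p : ℕ) (ζ : 𝓞 K) : Submonoid (𝓞 K) where
  carrier := {x | ∃ n : ℤ, IsCoprime n p ∧ (ζ - 1) ^ 2 ∣ x - n}
  one_mem' := ⟨1, isCoprime_one_left, by simp⟩
  mul_mem' := by
    rintro x y ⟨n, hn, hx⟩ ⟨n', hn', hy⟩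
    refine ⟨n * n', hn.mul_left hn', ?_⟩
    have : x * y - ((n * n' : ℤ) : 𝓞 K) = (x - n) * y + n * (y - n') := by push_cast; ring
    rw [this]
    exact dvd_add (hx.mul_right _) (hy.mul_left _)

/-- The group of the quotients of semi-primary integers. -/
def semiPrimaryGroup (p : ℕ) (ζ : 𝓞 K) : Subgroup Kˣ where
  carrier := {u | ∃ a ∈ semiPrimaryIntegers p ζ, ∃ b ∈ semiPrimaryIntegers p ζ,
    (u : K) * (b : K) = a}
  one_mem' := ⟨1, one_mem _, 1, one_mem _, by simp⟩
  mul_mem' := by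
    rintro x y ⟨a, ha, b, hb, h⟩ ⟨a', ha', b', hb', h'⟩
    refine ⟨a * a', mul_mem ha ha', b * b', mul_mem hb hb', ?_⟩
    change (x * y : K) * algebraMap (𝓞 K) K (b * b') = algebraMap (𝓞 K) K (a * a')
    rw [map_mul, map_mul]
    linear_combination (y * b' : K) * h + (a : K) * h'
  inv_mem' := by
    rintro x ⟨a, ha, b, hb, h⟩
    refine ⟨b, hb, a, ha, ?_⟩
    rw [← h]; simp

theorem mem_semiPrimaryGroup_of_integer {ζ : 𝓞 K} {a : 𝓞 K} (ha : a ∈ semiPrimaryIntegers p ζ)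
    {u : Kˣ} (hu : (u : K) = a) : u ∈ semiPrimaryGroup p ζ :=
  ⟨a, ha, 1, one_mem _, by simp [hu]⟩

theorem neg_one_mem_semiPrimaryGroup (p : ℕ) (ζ : 𝓞 K) : (-1 : Kˣ) ∈ semiPrimaryGroup p ζ :=
  ⟨-1, ⟨-1, isCoprime_one_left.neg_left, by simp⟩, 1, one_mem _, by simp⟩

theorem IsSemiPrimary.mem_semiPrimaryIntegers [NumberField K] {ζ A : 𝓞 K} (h : IsSemiPrimary p ζ A) :
    A ∈ semiPrimaryIntegers p ζ := by
  obtain ⟨a, ha, h⟩ := h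
  refine ⟨a, Nat.isCoprime_iff_coprime.mpr ha, ?_⟩
  rw [Ideal.span_singleton_pow, Ideal.mem_span_singleton] at h
  simpa using h

theorem map_mem_semiPrimaryIntegers {ζ a : 𝓞 K} (e : 𝓞 K ≃+* 𝓞 K) {v : ℕ} (he : e ζ = ζ ^ v)
    (ha : a ∈ semiPrimaryIntegers p ζ) : e a ∈ semiPrimaryIntegers p ζ := by
  obtain ⟨n, hn, h⟩ := ha
  refine ⟨n, hn, ?_⟩
  have h1 := map_dvd e h
  rw [map_pow, map_sub, map_sub, map_one, map_intCast, he] at h1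
  exact (pow_dvd_pow_of_dvd (sub_one_dvd_pow_sub_one ζ v) 2).trans h1

theorem map_mem_semiPrimaryGroup {ζ : 𝓞 K} {σ : K ≃+* K} {v : ℕ} (hσ : σ (ζ : K) = (ζ : K) ^ v)
    (x : Kˣ) (hx : x ∈ semiPrimaryGroup p ζ) :
    Units.map (σ : K →* K) x ∈ semiPrimaryGroup p ζ := by
  obtain ⟨a, ha, b, hb, h⟩ := hx
  have he : RingOfIntegers.mapRingEquiv σ ζ = ζ ^ v := by
    apply RingOfIntegers.coe_injective
    simpa using hσ
  refine ⟨_, map_mem_semiPrimaryIntegers _ he ha, _, map_mem_semiPrimaryIntegers _ he hb, ?_⟩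
  rw [RingOfIntegers.mapRingEquiv_apply, RingOfIntegers.mapRingEquiv_apply, ← h, map_mul]
  rfl

variable [Fact p.Prime] [NumberField K] [IsCyclotomicExtension {p} ℚ K]

/-- The only `p`-th root of unity that is semi-primary is `1`: modulo `(ζ - 1) ^ 2` one has
`ζ ^ k = 1 + k (ζ - 1)`. -/
theorem eq_one_of_pow_eq_one_of_mem {ζ : 𝓞 K} (hp : 2 < p) (hζ : IsPrimitiveRoot ζ p) {u : Kˣ}
    (hu : u ∈ semiPrimaryGroup p ζ) (hup : u ^ p = 1) : u = 1 := by
  have hζK : IsPrimitiveRoot (ζ : K) p := hζ.map_of_injective RingOfIntegers.coe_injective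
  have hpri : p.Prime := Fact.out
  obtain ⟨k, hk, hku⟩ := hζK.eq_pow_of_pow_eq_one (ξ := (u : K)) (by
    rw [← Units.val_pow_eq_pow_val, hup, Units.val_one])
  obtain ⟨a, ⟨n, hn, ha⟩, b, ⟨n', hn', hb⟩, h⟩ := hu
  have hab : ζ ^ k * b = a := by
    apply RingOfIntegers.coe_injective
    rw [map_mul, map_pow]
    exact (congrArg (· * (b : K)) hku).trans h
  have hne : ζ - 1 ≠ 0 := sub_ne_zero.mpr (hζ.ne_one hpri.one_lt)
  -- the ideal `(ζ - 1)` meets `ℤ` in `(p)`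
  have hdvd : ∀ z : ℤ, ζ - 1 ∣ (z : 𝓞 K) → (p : ℤ) ∣ z := by
    intro z hz
    have := IsCyclotomicExtension.Rat.zeta_sub_one_dvd_intCast_iff' p hζK (n := z)
    exact this.mp hz
  have hp2 : (ζ - 1) ^ 2 ∣ (p : 𝓞 K) := by
    obtain ⟨z, _, hz⟩ := hζ.self_sub_one_pow_dvd_order hp
    exact ⟨z, by rw [hz, mul_comm]⟩
  obtain ⟨y, hy⟩ : ∃ y, ζ ^ k = 1 + k * (ζ - 1) + y * (ζ - 1) ^ 2 := by
    clear hk hku hab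
    induction k with
    | zero => exact ⟨0, by simp⟩
    | succ k ih =>
      obtain ⟨y, hy⟩ := ih
      refine ⟨k + y * ζ, ?_⟩
      rw [pow_succ, hy]; push_cast; ring
  have h1 : (ζ - 1) ^ 2 ∣ ((n' - n : ℤ) : 𝓞 K) + (k * n' : ℤ) * (ζ - 1) := by
    have e : ((n' - n : ℤ) : 𝓞 K) + (k * n' : ℤ) * (ζ - 1) =
        (a - n) - (b - n') - (b - n') * (k * (ζ - 1)) - (ζ - 1) ^ 2 * (y * b) := by
      rw [← hab, hy]; push_cast; ring
    rw [e]
    exact dvd_sub (dvd_sub (dvd_sub ha hb) (hb.mul_right _)) (dvd_mul_right _ _)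
  have h2 : (p : ℤ) ∣ n' - n := by
    apply hdvd
    have := (dvd_pow_self (ζ - 1) two_ne_zero).trans h1
    rwa [dvd_add_left (dvd_mul_left _ _)] at this
  have h3 : (ζ - 1) ^ 2 ∣ (k * n' : ℤ) * (ζ - 1) := by
    refine (dvd_add_right ?_).mp h1
    obtain ⟨z, hz⟩ := h2
    rw [hz]; push_cast
    exact hp2.mul_right _
  have h4 : (p : ℤ) ∣ k * n' := by
    apply hdvd
    rw [sq, mul_comm] at h3
    rw [mul_comm] at h3
    exact (mul_dvd_mul_iff_right hne).mp h3
  have h5 : (p : ℤ) ∣ k := hn'.symm.dvd_of_dvd_mul_right h4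
  have h6 : k = 0 := Nat.eq_zero_of_dvd_of_lt (Int.natCast_dvd_natCast.mp h5) hk
  ext
  rw [← hku, h6, pow_zero, Units.val_one]

end SemiPrimary

section TraceCharacter

variable {K : Type*} [Field K] [NumberField K] (𝔮 : Ideal (𝓞 K)) (q : ℕ) [Fact q.Prime]
  [CharP (𝓞 K ⧸ 𝔮) q] {R : Type*} [CommRing R]

/-- The additive character `x ↦ ξ ^ Tr(x)` of the residue field. -/
noncomputable def traceChar {ξ : R} (hξ : ξ ^ q = 1) : AddChar (𝓞 K ⧸ 𝔮) R :=
  letI : Algebra (ZMod q) (𝓞 K ⧸ 𝔮) := ZMod.algebra (𝓞 K ⧸ 𝔮) q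
  haveI : NeZero q := ⟨(Fact.out : q.Prime).ne_zero⟩
  (AddChar.zmodChar q hξ).compAddMonoidHom
    (Algebra.trace (ZMod q) (𝓞 K ⧸ 𝔮)).toAddMonoidHom

theorem traceChar_apply {ξ : R} (hξ : ξ ^ q = 1) (x : 𝓞 K ⧸ 𝔮) :
    traceChar 𝔮 q hξ x = ξ ^ (residueTrace 𝔮 q x).val := rfl

end TraceCharacter

/-! ### The residue character and its Gauss sum -/

section ResidueCharacter

variable {p : ℕ} [Fact p.Prime] {K : Type*} [Field K] [NumberField K]
  [IsCyclotomicExtension {p} ℚ K] {ζ : 𝓞 K} {q : ℕ} [Fact q.Prime] {𝔮 : Ideal (𝓞 K)}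
  [CharP (𝓞 K ⧸ 𝔮) q] [𝔮.IsPrime]

/-- The `p`-th power residue symbol is a multiplicative character `ρ` of order `p` of the residue
field. -/
theorem exists_residueChar (hζ : IsPrimitiveRoot ζ p) (hqp : q ≠ p) (h𝔮 : 𝔮 ≠ ⊥) :
    ∃ ρ : MulChar (𝓞 K ⧸ 𝔮) (𝓞 K), orderOf ρ = p ∧
      (∀ x, x ≠ 0 → Ideal.Quotient.mk 𝔮 (ρ x) = x ^ ((Ideal.absNorm 𝔮 - 1) / p)) ∧
      ∀ x, residueSymbol p 𝔮 x = ρ x := by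
  have : 𝔮.IsMaximal := Ideal.IsPrime.isMaximal inferInstance h𝔮
  let _ : Field (𝓞 K ⧸ 𝔮) := Ideal.Quotient.field 𝔮
  have : Finite (𝓞 K ⧸ 𝔮) := Ideal.finiteQuotientOfFreeOfNeBot 𝔮 h𝔮
  let _ : Fintype (𝓞 K ⧸ 𝔮) := Fintype.ofFinite _
  have hcard : Ideal.absNorm 𝔮 = Fintype.card (𝓞 K ⧸ 𝔮) := by
    rw [Ideal.absNorm_apply, Submodule.cardQuot_apply, Nat.card_eq_fintype_card]
  have hpri : p.Prime := Fact.out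
  have hdvd := (absNorm_eq_pow_orderOf (𝔮 := 𝔮) (q := q) hζ hqp h𝔮).2
  have hm : 1 < Fintype.card (𝓞 K ⧸ 𝔮) := Fintype.one_lt_card
  have hc : 0 < (Ideal.absNorm 𝔮 - 1) / p :=
    Nat.div_pos (Nat.le_of_dvd (by omega) hdvd) hpri.pos
  obtain ⟨ρ, hρp, hρ⟩ := exists_mulChar_lift 𝔮 (RingHom.id (𝓞 K ⧸ 𝔮)) hpri.pos (hcard ▸ hdvd) hζ
  simp only [RingHom.id_apply, ← hcard] at hρ
  refine ⟨ρ, orderOf_eq_prime hρp fun h1 => ?_, hρ, fun x => ?_⟩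
  · obtain ⟨g, hg⟩ := IsCyclic.exists_generator (α := (𝓞 K ⧸ 𝔮)ˣ)
    have h2 := hρ g g.ne_zero
    rw [h1, MulChar.one_apply_coe, map_one] at h2
    have h3 : g ^ ((Ideal.absNorm 𝔮 - 1) / p) = 1 := by ext1; simpa using h2.symm
    have h4 := orderOf_dvd_of_pow_eq_one h3
    classical
    rw [orderOf_eq_card_of_forall_mem_zpowers hg, Nat.card_eq_fintype_card, Fintype.card_units,
      ← hcard] at h4
    exact absurd (Nat.le_of_dvd hc h4) (not_le.mpr (Nat.div_lt_self (by omega) hpri.one_lt))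
  · rw [residueSymbol]
    rcases eq_or_ne x 0 with rfl | hx
    · -- no `p`-th root of unity reduces to `0`
      rw [dif_neg, MulChar.map_zero]
      rintro ⟨β, hβ, hβ0⟩
      rw [zero_pow hc.ne'] at hβ0
      have := congrArg (Ideal.Quotient.mk 𝔮) hβ
      rw [map_pow, hβ0, zero_pow hpri.ne_zero, map_one] at this
      exact zero_ne_one this
    · have hρx : ρ x ^ p = 1 := by
        rw [← MulChar.pow_apply' _ hpri.ne_zero, hρp]
        exact MulChar.one_apply hx.isUnit
      have h : ∃ β : 𝓞 K, β ^ p = 1 ∧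
          Ideal.Quotient.mk 𝔮 β = x ^ ((Ideal.absNorm 𝔮 - 1) / p) := ⟨ρ x, hρx, hρ x hx⟩
      rw [dif_pos h]
      exact eq_of_mk_eq_of_pow_eq_one 𝔮 (natCast_notMem_of_ne (q := q) hqp) h.choose_spec.1 hρx
        (h.choose_spec.2.trans (hρ x hx).symm)

end ResidueCharacter

section GaussSum

variable {p : ℕ} {K : Type*} [Field K] [NumberField K] {q : ℕ} [Fact q.Prime] {𝔮 : Ideal (𝓞 K)}
  [CharP (𝓞 K ⧸ 𝔮) q] [𝔮.IsPrime]

theorem gSum_eq_sum [Fintype (𝓞 K ⧸ 𝔮)] (h𝔮 : 𝔮 ≠ ⊥) {ρ : MulChar (𝓞 K ⧸ 𝔮) (𝓞 K)}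
    (hρ : ∀ x, residueSymbol p 𝔮 x = ρ x) {L : Type*} [Field L] [Algebra K L] (ξ : L) :
    gSum p 𝔮 q ξ = ∑ x, algebraMap K L (algebraMap (𝓞 K) K (ρ⁻¹ x)) *
      ξ ^ (residueTrace 𝔮 q x).val := by
  have : 𝔮.IsMaximal := Ideal.IsPrime.isMaximal inferInstance h𝔮
  let _ : Field (𝓞 K ⧸ 𝔮) := Ideal.Quotient.field 𝔮
  rw [gSum, finsum_eq_sum_of_fintype]
  refine Finset.sum_congr rfl fun x _ => ?_
  rw [hρ]
  congr 2
  rcases eq_or_ne x 0 with rfl | hx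
  · rw [MulChar.map_zero, MulChar.map_zero]
    change (algebraMap (𝓞 K) K 0)⁻¹ = algebraMap (𝓞 K) K 0
    rw [map_zero, inv_zero]
  · symm
    apply eq_inv_of_mul_eq_one_left
    rw [← map_mul, MulChar.inv_apply', ← map_mul, inv_mul_cancel₀ hx, map_one, map_one]

theorem traceChar_ne_one (h𝔮 : 𝔮 ≠ ⊥) {R : Type*} [CommRing R] {ξ : R} (hξ : IsPrimitiveRoot ξ q) :
    traceChar 𝔮 q hξ.pow_eq_one ≠ 1 := by
  have : 𝔮.IsMaximal := Ideal.IsPrime.isMaximal inferInstance h𝔮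
  let _ : Field (𝓞 K ⧸ 𝔮) := Ideal.Quotient.field 𝔮
  have : Finite (𝓞 K ⧸ 𝔮) := Ideal.finiteQuotientOfFreeOfNeBot 𝔮 h𝔮
  let _ : Algebra (ZMod q) (𝓞 K ⧸ 𝔮) := ZMod.algebra (𝓞 K ⧸ 𝔮) q
  intro h
  obtain ⟨x, hx⟩ := Algebra.trace_surjective (ZMod q) (𝓞 K ⧸ 𝔮) 1
  have h1 := DFunLike.congr_fun h x
  rw [traceChar_apply, AddChar.one_apply] at h1
  have h2 : residueTrace 𝔮 q x = 1 := hx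
  have : Fact (1 < q) := ⟨(Fact.out : q.Prime).one_lt⟩
  rw [h2, ZMod.val_one, pow_one] at h1
  exact hξ.ne_one this.out h1

end GaussSum

section JacobiProduct

/-- The product of Jacobi sums that equals the `n`-th power of a Gauss sum of a character `χ` of
odd order `n`. -/
noncomputable def jacobiProduct {F R : Type*} [CommRing F] [Fintype F] [CommRing R]
    (χ : MulChar F R) : R :=
  Fintype.card F * ∏ i ∈ Finset.Ico 1 (orderOf χ - 1), jacobiSum χ (χ ^ i)

variable {F R : Type*} [Field F] [Fintype F] [CommRing R] [IsDomain R]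

theorem apply_neg_one_of_odd_orderOf {χ : MulChar F R} (hχ : Odd (orderOf χ)) :
    χ (-1) = 1 := by
  have h1 : χ (-1) ^ orderOf χ = 1 := by
    rw [← MulChar.pow_apply' _ hχ.pos.ne', pow_orderOf_eq_one]
    exact MulChar.one_apply isUnit_one.neg
  have h2 : χ (-1) * χ (-1) = 1 := by rw [← map_mul]; simp
  rcases mul_self_eq_one_iff.mp h2 with h | h
  · exact h
  · rw [h, hχ.neg_one_pow] at h1
    rw [h, h1]

theorem orderOf_ringHomComp {S : Type*} [CommRing S] {f : R →+* S} (hf : Function.Injective f)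
    (χ : MulChar F R) : orderOf (χ.ringHomComp f) = orderOf χ := by
  rw [orderOf_eq_orderOf_iff]
  intro n
  rw [MulChar.ringHomComp_pow, MulChar.ringHomComp_eq_one_iff hf]

theorem gaussSum_ringHomComp_pow {S : Type*} [CommRing S] [IsDomain S] {f : R →+* S}
    (hf : Function.Injective f) {χ : MulChar F R} {n : ℕ} (hχ : orderOf χ = n) (hn : Odd n)
    (hn1 : 2 ≤ n) {ψ : AddChar F S} (hψ : ψ ≠ 1) :
    gaussSum (χ.ringHomComp f) ψ ^ n = f (jacobiProduct χ) := by
  subst hχ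
  have h := gaussSum_pow_eq_prod_jacobiSum (χ := χ.ringHomComp f)
    (by rwa [orderOf_ringHomComp hf]) (AddChar.IsPrimitive.of_ne_one hψ)
  rw [orderOf_ringHomComp hf, apply_neg_one_of_odd_orderOf
    (by rwa [orderOf_ringHomComp hf]), one_mul] at h
  rw [h, jacobiProduct, map_mul, map_natCast, map_prod]
  congr 1
  refine Finset.prod_congr rfl fun i _ => ?_
  rw [MulChar.ringHomComp_pow, jacobiSum_ringHomComp]

/-- The absolute value of a Gauss sum, in algebraic form. -/
theorem jacobiProduct_mul_inv {S : Type*} [CommRing S] [IsDomain S] {f : R →+* S}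
    (hf : Function.Injective f) {χ : MulChar F R} {n : ℕ} (hχ : orderOf χ = n) (hn : Odd n)
    (hn1 : 2 ≤ n) {ψ : AddChar F S} (hψ : ψ ≠ 1) :
    jacobiProduct χ * jacobiProduct χ⁻¹ = (Fintype.card F : R) ^ n := by
  apply hf
  have hχ1 : χ.ringHomComp f ≠ 1 := by
    rw [Ne, MulChar.ringHomComp_eq_one_iff hf, ← orderOf_eq_one_iff]
    omega
  rw [map_mul, ← gaussSum_ringHomComp_pow hf hχ hn hn1 hψ,
    ← gaussSum_ringHomComp_pow hf (χ := χ⁻¹) (by rw [orderOf_inv, hχ]) hn hn1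
      (ψ := ψ⁻¹) (by rwa [Ne, inv_eq_one]), ← mul_pow, ← MulChar.ringHomComp_inv,
    gaussSum_mul_gaussSum_eq_card hχ1 (AddChar.IsPrimitive.of_ne_one hψ), map_pow, map_natCast]

theorem map_jacobiProduct {S : Type*} [CommRing S] (f : R →+* S) {χ : MulChar F R}
    {χ' : MulChar F S} (h : χ.ringHomComp f = χ') (ho : orderOf χ = orderOf χ') :
    f (jacobiProduct χ) = jacobiProduct χ' := by
  rw [jacobiProduct, jacobiProduct, map_mul, map_natCast, map_prod, ho]
  congr 1
  refine Finset.prod_congr rfl fun i _ => ?_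
  rw [← jacobiSum_ringHomComp, ← MulChar.ringHomComp_pow, h]

theorem jacobiProduct_mem_semiPrimaryIntegers {p : ℕ} (hp : 2 < p) {K : Type*} [Field K]
    {ζ : 𝓞 K} (hζ : IsPrimitiveRoot ζ p) {χ : MulChar F (𝓞 K)} (hχ : orderOf χ = p)
    (hdvd : p ∣ Fintype.card F - 1) : jacobiProduct χ ∈ semiPrimaryIntegers p ζ := by
  refine mul_mem ⟨Fintype.card F, ?_, by simp⟩ (Submonoid.prod_mem _ fun i _ => ?_)
  · obtain ⟨c, hc⟩ := hdvd
    have hm : 1 < Fintype.card F := Fintype.one_lt_card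
    refine ⟨1, -c, ?_⟩
    have : (Fintype.card F : ℤ) = p * c + 1 := by
      rw [← Nat.cast_mul, ← hc]; push_cast [hm.le]; ring
    rw [this]; ring
  · obtain ⟨z, _, hz⟩ := exists_jacobiSum_eq_neg_one_add hp (χ := χ) (ψ := χ ^ i) (n := p)
      (by rw [← hχ, pow_orderOf_eq_one]) (by rw [← pow_mul, mul_comm, pow_mul, ← hχ,
        pow_orderOf_eq_one, one_pow]) hdvd hζ
    refine ⟨-1, isCoprime_one_left.neg_left, z, ?_⟩
    rw [hz]; push_cast; ring

end JacobiProduct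

/-! ### The valuation of the Gauss sum at the primes above `q` -/

section LocalComparison

variable {p : ℕ} [Fact p.Prime] {K : Type*} [Field K] [NumberField K]
  [IsCyclotomicExtension {p} ℚ K] {ζ : 𝓞 K} {v : ℕ} {σ : K ≃+* K} {q : ℕ} [Fact q.Prime]
  {𝔮 : Ideal (𝓞 K)} [CharP (𝓞 K ⧸ 𝔮) q] [𝔮.IsPrime]
  {R : Type*} [CommRing R] {Γ₀ : Type*} [LinearOrderedCommGroupWithZero Γ₀]
  {w : Valuation R Γ₀} {P : Ideal R} [P.IsPrime] {ι : 𝓞 K →+* R} {k : ℕ}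

theorem natCast_mem_of_map_mem (hk : ∀ x ∈ 𝔮, ι (RingOfIntegers.mapRingEquiv (σ ^ k) x) ∈ P) :
    (q : R) ∈ P := by
  have := hk _ (natCast_mem_of_charP (q := q))
  rwa [map_natCast, map_natCast] at this

/-- The upper bound in Stickelberger's theorem for the Gauss sum `g` of the inverse of the power
residue symbol modulo `𝔮`, at a prime `P` that meets `𝓞 K` in `σ ^ k (𝔮)`. -/
theorem valuation_pow_le_gaussSum_residueChar [IsDomain R] [Fintype (𝓞 K ⧸ 𝔮)]
    (hw : ∀ x, w x ≤ 1) (hP : ∀ x, w x < 1 ↔ x ∈ P)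
    (hζ : IsPrimitiveRoot ζ p) (hσ : σ (ζ : K) = (ζ : K) ^ v) (hqp : q ≠ p) (h𝔮 : 𝔮 ≠ ⊥)
    (hk : ∀ x ∈ 𝔮, ι (RingOfIntegers.mapRingEquiv (σ ^ k) x) ∈ P)
    {η : R} (hη : IsPrimitiveRoot η (Ideal.absNorm 𝔮 - 1)) {ξ : R} (hξ : IsPrimitiveRoot ξ q)
    {ρ : MulChar (𝓞 K ⧸ 𝔮) (𝓞 K)} (hρp : orderOf ρ = p)
    (hρ : ∀ x, x ≠ 0 → Ideal.Quotient.mk 𝔮 (ρ x) = x ^ ((Ideal.absNorm 𝔮 - 1) / p))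
    {t : ℕ} (ht : t < p) (htk : (t : ZMod p) * (v : ZMod p) ^ k = 1) :
    w (q : R) ^ (∑ j ∈ Finset.range (orderOf (q : ZMod p)), t * q ^ j % p) ≤
      w (gaussSum (ρ⁻¹.ringHomComp ι) (traceChar 𝔮 q hξ.pow_eq_one)) ^ p := by
  have : 𝔮.IsMaximal := Ideal.IsPrime.isMaximal inferInstance h𝔮
  let _ : Field (𝓞 K ⧸ 𝔮) := Ideal.Quotient.field 𝔮
  let _ : Algebra (ZMod q) (𝓞 K ⧸ 𝔮) := ZMod.algebra (𝓞 K ⧸ 𝔮) q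
  have hpri : p.Prime := Fact.out
  have hcard : Ideal.absNorm 𝔮 = Fintype.card (𝓞 K ⧸ 𝔮) := by
    rw [Ideal.absNorm_apply, Submodule.cardQuot_apply, Nat.card_eq_fintype_card]
  obtain ⟨hqf, hdvd⟩ := absNorm_eq_pow_orderOf (𝔮 := 𝔮) (q := q) hζ hqp h𝔮
  have hm : 1 < Fintype.card (𝓞 K ⧸ 𝔮) := Fintype.one_lt_card
  set c := (Ideal.absNorm 𝔮 - 1) / p with hc
  have hcp : c * p = Fintype.card (𝓞 K ⧸ 𝔮) - 1 := by rw [hc, Nat.div_mul_cancel hdvd, hcard]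
  have hpP : (p : R) ∉ P := by
    intro h
    have hcop : IsCoprime (p : ℤ) q := by
      rw [Nat.isCoprime_iff_coprime, Nat.coprime_primes hpri Fact.out]; exact hqp.symm
    obtain ⟨a, b, hab⟩ := hcop
    apply (inferInstance : P.IsPrime).ne_top
    rw [Ideal.eq_top_iff_one]
    have h1 : ((a * p + b * q : ℤ) : R) = 1 := by rw [hab, Int.cast_one]
    rw [← h1]; push_cast
    exact add_mem (P.mul_mem_left _ h) (P.mul_mem_left _ (natCast_mem_of_map_mem (q := q) hk))
  let ι' : 𝓞 K →+* R := ι.comp (RingOfIntegers.mapRingEquiv (σ ^ k) : 𝓞 K →+* 𝓞 K)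
  let θ : (𝓞 K ⧸ 𝔮) →+* R ⧸ P := Ideal.quotientMap P ι' hk
  -- the Teichmüller character
  obtain ⟨ω, hω1, hω⟩ := exists_mulChar_lift P θ (n := Fintype.card (𝓞 K ⧸ 𝔮) - 1) (by omega)
    dvd_rfl (hcard ▸ hη)
  rw [Nat.div_self (by omega)] at hω
  simp only [pow_one] at hω
  have key : ρ.ringHomComp ι = ω ^ (c * t) := by
    ext x
    have hx : (x : 𝓞 K ⧸ 𝔮) ≠ 0 := x.ne_zero
    have hρx : ρ x ^ p = 1 := by
      rw [← MulChar.pow_apply_coe, ← hρp, pow_orderOf_eq_one, MulChar.one_apply_coe]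
    obtain ⟨e, _, he⟩ := hζ.eq_pow_of_pow_eq_one hρx
    have h1 : ι' (ρ x) = ω x ^ c := by
      apply eq_of_mk_eq_of_pow_eq_one P hpP
      · rw [← map_pow, hρx, map_one]
      · rw [← pow_mul, hcp, ← MulChar.pow_apply_coe, hω1, MulChar.one_apply_coe]
      · rw [map_pow, hω _ hx, ← map_pow, ← hρ _ hx]
        rfl
    have h2 : RingOfIntegers.mapRingEquiv (σ ^ k) (ρ x) ^ t = ρ x := by
      rw [← he, map_pow, mapRingEquiv_zeta hσ, ← pow_mul, ← pow_mul]
      apply zeta_pow_eq_of_zmod_eq hζ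
      push_cast
      linear_combination (e : ZMod p) * htk
    rw [MulChar.ringHomComp_apply, MulChar.pow_apply_coe, pow_mul, ← h1, ← map_pow, RingHom.comp_apply,
      map_pow]
    exact congrArg ι h2.symm
  rw [← MulChar.ringHomComp_inv, key, ← inv_pow]
  exact valuation_pow_le_gaussSum_pow hw hP hω (hcard ▸ hqf) hpri.one_lt hcp hξ
    (fun x => traceChar_apply 𝔮 q hξ.pow_eq_one x) (traceChar_ne_one h𝔮 hξ) ht

/-- A generator of `𝔮 ^ n` is locally at least as divisible as `q ^ n`, at all the primes conjugate
to `𝔮` by a power of the Frobenius. -/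
theorem valuation_generator_le (hw : ∀ x, w x ≤ 1) (hP : ∀ x, w x < 1 ↔ x ∈ P)
    (hζ : IsPrimitiveRoot ζ p) (hσ : σ (ζ : K) = (ζ : K) ^ v) (hqp : q ≠ p) (h𝔮 : 𝔮 ≠ ⊥)
    (hk : ∀ x ∈ 𝔮, ι (RingOfIntegers.mapRingEquiv (σ ^ k) x) ∈ P)
    {A : 𝓞 K} {n : ℕ} (hA : Ideal.span {A} = 𝔮 ^ n) {i l j : ℕ}
    (hi : i = k + l) (hl : (v : ZMod p) ^ l = (q : ZMod p) ^ j) :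
    w (ι (RingOfIntegers.mapRingEquiv (σ ^ i) A)) ≤ w (q : R) ^ n := by
  obtain ⟨b, hb, c, hbc⟩ := exists_mul_eq_pow_mul (q := q) hζ hqp h𝔮 hA
  have : 𝔮.IsMaximal := Ideal.IsPrime.isMaximal inferInstance h𝔮
  let ι' : 𝓞 K →+* R := ι.comp (RingOfIntegers.mapRingEquiv (σ ^ k) : 𝓞 K →+* 𝓞 K)
  have hcomap : 𝔮 = P.comap ι' :=
    this.eq_of_le (Ideal.IsPrime.ne_top inferInstance) hk
  have hlb : RingOfIntegers.mapRingEquiv (σ ^ l) b ∉ 𝔮 := by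
    intro h
    rw [← Ideal.Quotient.eq_zero_iff_mem, mk_automorphism_pow hζ hσ 𝔮 hl, ← map_pow,
      Ideal.Quotient.eq_zero_iff_mem] at h
    exact hb (Ideal.IsPrime.mem_of_pow_mem inferInstance _ h)
  have hib : ι (RingOfIntegers.mapRingEquiv (σ ^ i) b) ∉ P := by
    intro h
    apply hlb
    rw [hcomap, Ideal.mem_comap]
    rw [hi, pow_add] at h
    exact h
  have hwb : w (ι (RingOfIntegers.mapRingEquiv (σ ^ i) b)) = 1 :=
    le_antisymm (hw _) (not_lt.mp fun h => hib ((hP _).mp h))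
  have h1 := congrArg (fun x => w (ι (RingOfIntegers.mapRingEquiv (σ ^ i) x))) hbc
  simp only [map_mul, map_pow, map_natCast, hwb, mul_one] at h1
  rw [h1]
  exact mul_le_of_le_one_right' (hw _)

/-- At the primes above `q`, the element `A ^ P(σ)` is at least as divisible as the power
`g ^ (n p)` of the Gauss sum. -/
theorem valuation_prod_le_gaussSum_pow [IsDomain R] [Fintype (𝓞 K ⧸ 𝔮)]
    (hw : ∀ x, w x ≤ 1) (hP : ∀ x, w x < 1 ↔ x ∈ P) (hp : 2 < p)
    (hζ : IsPrimitiveRoot ζ p) (hv : orderOf (v : ZMod p) = p - 1)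
    (hσ : σ (ζ : K) = (ζ : K) ^ v) (hqp : q ≠ p) (h𝔮 : 𝔮 ≠ ⊥)
    (hk : ∀ x ∈ 𝔮, ι (RingOfIntegers.mapRingEquiv (σ ^ k) x) ∈ P)
    {η : R} (hη : IsPrimitiveRoot η (Ideal.absNorm 𝔮 - 1)) {ξ : R} (hξ : IsPrimitiveRoot ξ q)
    {ρ : MulChar (𝓞 K ⧸ 𝔮) (𝓞 K)} (hρp : orderOf ρ = p)
    (hρ : ∀ x, x ≠ 0 → Ideal.Quotient.mk 𝔮 (ρ x) = x ^ ((Ideal.absNorm 𝔮 - 1) / p))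
    {A : 𝓞 K} {n : ℕ} (hA : Ideal.span {A} = 𝔮 ^ n) :
    w (ι (∏ i ∈ Finset.range (p - 1), RingOfIntegers.mapRingEquiv (σ ^ i) A ^
        ((v : ZMod p) ^ (-(i : ℤ))).val)) ≤
      (w (gaussSum (ρ⁻¹.ringHomComp ι) (traceChar 𝔮 q hξ.pow_eq_one)) ^ p) ^ n := by
  have hv0 := ne_zero_of_orderOf p v hp hv
  have hq0 := zmod_ne_zero_of_ne (p := p) hqp
  set f := orderOf (q : ZMod p) with hf
  have hgen : ∀ x : ZMod p, x ≠ 0 → ∃ i < p - 1, (v : ZMod p) ^ i = x := fun x hx =>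
    exists_pow_eq_of_orderOf p v hp hv hx
  set t := ((v : ZMod p) ^ (-(k : ℤ))).val with ht
  have htk : (t : ZMod p) * (v : ZMod p) ^ k = 1 := by
    rw [ht, ZMod.natCast_zmod_val, zpow_neg, zpow_natCast, inv_mul_cancel₀ (pow_ne_zero _ hv0)]
  -- the exponents `i` with `v ^ i q ^ j = v ^ k`, that is, with `σ ^ i (𝔮) = σ ^ k (𝔮)`
  choose! I hI hIv using fun j : ℕ => hgen ((v : ZMod p) ^ k * ((q : ZMod p) ^ j)⁻¹)
    (mul_ne_zero (pow_ne_zero _ hv0) (inv_ne_zero (pow_ne_zero _ hq0)))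
  have hInj : Set.InjOn I (Finset.range f) := by
    intro j hj j' hj' h
    have h1 := (hIv j).symm.trans ((congrArg ((v : ZMod p) ^ ·) h).trans (hIv j'))
    have h2 := inv_injective (mul_left_cancel₀ (pow_ne_zero _ hv0) h1)
    exact pow_injOn_Iio_orderOf (by simpa using hj) (by simpa using hj') h2
  have hval : ∀ j, ((v : ZMod p) ^ (-(I j : ℤ))).val = t * q ^ j % p := by
    intro j
    rw [← ZMod.val_natCast]
    congr 1
    rw [zpow_neg, zpow_natCast, hIv, mul_inv, inv_inv]
    push_cast
    rw [ht, ZMod.natCast_zmod_val, zpow_neg, zpow_natCast]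
  have hbound : ∀ j, w (ι (RingOfIntegers.mapRingEquiv (σ ^ I j) A)) ≤ w (q : R) ^ n := by
    intro j
    obtain ⟨l, hl, hlv⟩ := hgen (((q : ZMod p) ^ (j * (p - 2)))) (pow_ne_zero _ hq0)
    have hIk : σ ^ I j = σ ^ (k + l) := by
      refine automorphism_pow_eq_pow hζ hσ ?_
      rw [hIv, pow_add, hlv]
      congr 1
      refine inv_eq_of_mul_eq_one_right ?_
      rw [← pow_add, show j + j * (p - 2) = (p - 1) * j by
        obtain ⟨r, hr⟩ : ∃ r, p = r + 2 := ⟨p - 2, by omega⟩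
        rw [hr, Nat.add_sub_cancel, show r + 2 - 1 = r + 1 by omega]; ring,
        pow_mul, ZMod.pow_card_sub_one_eq_one hq0, one_pow]
    rw [hIk]
    exact valuation_generator_le hw hP hζ hσ hqp h𝔮 hk hA rfl hlv
  have hG := valuation_pow_le_gaussSum_residueChar hw hP hζ hσ hqp h𝔮 hk hη hξ hρp hρ
    (ZMod.val_lt _) htk
  rw [map_prod, map_prod]
  calc ∏ i ∈ Finset.range (p - 1), w (ι (RingOfIntegers.mapRingEquiv (σ ^ i) A ^
        ((v : ZMod p) ^ (-(i : ℤ))).val))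
      ≤ ∏ i ∈ (Finset.range f).image I, w (ι (RingOfIntegers.mapRingEquiv (σ ^ i) A ^
        ((v : ZMod p) ^ (-(i : ℤ))).val)) := by
        refine Finset.prod_le_prod_of_subset_of_le_one' ?_ fun i _ _ => hw _
        intro i hi
        obtain ⟨j, _, rfl⟩ := Finset.mem_image.mp hi
        exact Finset.mem_range.mpr (hI j)
    _ = ∏ j ∈ Finset.range f, w (ι (RingOfIntegers.mapRingEquiv (σ ^ I j) A)) ^
        (t * q ^ j % p) := by
        rw [Finset.prod_image hInj]
        refine Finset.prod_congr rfl fun j _ => ?_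
        rw [hval, map_pow, map_pow]
    _ ≤ ∏ j ∈ Finset.range f, (w (q : R) ^ n) ^ (t * q ^ j % p) :=
        Finset.prod_le_prod' fun j _ => pow_le_pow_left' (hbound j) _
    _ = (w (q : R) ^ (∑ j ∈ Finset.range f, t * q ^ j % p)) ^ n := by
        rw [Finset.prod_pow_eq_pow_sum, ← pow_mul, ← pow_mul, mul_comm]
    _ ≤ _ := pow_le_pow_left' hG _

end LocalComparison

/-! ### Integrality of the quotient -/

section PolyExpSum

variable {M : Type*} [Field M] (s : M ≃+* M)

theorem polyExp_C_mul_X_pow (n : ℤ) (i : ℕ) {x : M} (hx : x ≠ 0) :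
    polyExp s (C n * X ^ i) x = (s ^ i : M ≃+* M) x ^ n := by
  rw [polyExp_mul s _ _ hx, polyExp_X_pow s i hx,
    show (C n : ℤ[X]) = (n : ℤ[X]) from eq_intCast (C : ℤ →+* ℤ[X]) n,
    polyExp_intCast s n ((map_ne_zero_iff _ (s ^ i).injective).mpr hx)]

theorem polyExp_sum {ι : Type*} (S : Finset ι) (F : ι → ℤ[X]) {x : M} (hx : x ≠ 0) :
    polyExp s (∑ i ∈ S, F i) x = ∏ i ∈ S, polyExp s (F i) x := by
  classical
  induction S using Finset.induction_on with
  | empty => simp [polyExp]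
  | insert a S ha ih => rw [Finset.sum_insert ha, Finset.prod_insert ha, polyExp_add s _ _ hx, ih]

theorem polyExp_natCast_mul (n : ℕ) (F : ℤ[X]) {x : M} (hx : x ≠ 0) :
    polyExp s ((n : ℤ[X]) * F) x = polyExp s F x ^ n := by
  rw [polyExp_mul s _ _ hx, polyExp_natCast s n (polyExp_ne_zero s F hx)]

theorem polyExp_stickP (p : ℕ) [Fact p.Prime] (v : ℕ) {x : M} (hx : x ≠ 0) :
    polyExp s (stickP p v) x =
      ∏ i ∈ Finset.range (p - 1), (s ^ i : M ≃+* M) x ^ ((v : ZMod p) ^ (-(i : ℤ))).val := by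
  rw [stickP, polyExp_sum s _ _ hx]
  refine Finset.prod_congr rfl fun i _ => ?_
  rw [polyExp_C_mul_X_pow s _ _ hx, vres, zpow_natCast]

end PolyExpSum

section Global

variable {p : ℕ} [Fact p.Prime] {K : Type*} [Field K] [NumberField K]
  [IsCyclotomicExtension {p} ℚ K] {ζ : 𝓞 K} {v : ℕ} {σ : K ≃+* K} {q : ℕ} [Fact q.Prime]
  {𝔮 : Ideal (𝓞 K)} [CharP (𝓞 K ⧸ 𝔮) q] [𝔮.IsPrime]

theorem coe_prod_mapRingEquiv {p v : ℕ} [Fact p.Prime] {K : Type*} [Field K] (σ : K ≃+* K)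
    {A : 𝓞 K} (hA : A ≠ 0) :
    ((∏ i ∈ Finset.range (p - 1), RingOfIntegers.mapRingEquiv (σ ^ i) A ^
        ((v : ZMod p) ^ (-(i : ℤ))).val : 𝓞 K) : K) = polyExp σ (stickP p v) (A : K) := by
  rw [polyExp_stickP σ p v (RingOfIntegers.coe_ne_zero_iff.mpr hA)]
  refine (map_prod (algebraMap (𝓞 K) K) _ _).trans (Finset.prod_congr rfl fun i _ => ?_)
  rw [map_pow]; rfl

theorem prod_mapRingEquiv_eq_norm (hζ : IsPrimitiveRoot ζ p)
    (hv : orderOf (v : ZMod p) = p - 1) (hσ : σ (ζ : K) = (ζ : K) ^ v) (A : 𝓞 K) :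
    ∏ i ∈ Finset.range (p - 1), RingOfIntegers.mapRingEquiv (σ ^ i) A =
      ((Algebra.norm ℤ A : ℤ) : 𝓞 K) := by
  apply RingOfIntegers.coe_injective
  have h := prod_automorphisms hζ hv hσ (A : K)
  rw [← Algebra.coe_norm_int] at h
  rw [map_prod, map_intCast]
  simpa using h

theorem natAbs_norm_eq {A : 𝓞 K} {n : ℕ} (hA : Ideal.span {A} = 𝔮 ^ n) :
    (Algebra.norm ℤ A).natAbs = Ideal.absNorm 𝔮 ^ n := by
  rw [← Ideal.absNorm_span_singleton, hA, map_pow]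

/-- A prime above `q` in an extension of `K` contracts to a conjugate of `𝔮`. -/
theorem exists_conjugate_mem (hζ : IsPrimitiveRoot ζ p)
    (hv : orderOf (v : ZMod p) = p - 1) (hσ : σ (ζ : K) = (ζ : K) ^ v) (hqp : q ≠ p) (h𝔮 : 𝔮 ≠ ⊥)
    {A : 𝓞 K} {n : ℕ} (hA : Ideal.span {A} = 𝔮 ^ n) (hn : n ≠ 0)
    {R : Type*} [CommRing R] {P : Ideal R} [P.IsPrime] (ι : 𝓞 K →+* R) (hqP : (q : R) ∈ P) :
    ∃ k, ∀ x ∈ 𝔮, ι (RingOfIntegers.mapRingEquiv (σ ^ k) x) ∈ P := by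
  have hN := natAbs_norm_eq hA
  rw [(absNorm_eq_pow_orderOf (q := q) hζ hqp h𝔮).1] at hN
  have hf0 : orderOf (q : ZMod p) ≠ 0 := by
    rw [← pos_iff_ne_zero, orderOf_pos_iff]
    exact isOfFinOrder_iff_isUnit.mpr (zmod_ne_zero_of_ne hqp).isUnit
  have hdvd : (q : ℤ) ∣ Algebra.norm ℤ A := by
    rw [← Int.dvd_natAbs, hN]; push_cast
    exact dvd_pow (dvd_pow_self _ hf0) hn
  have h1 : ι (∏ i ∈ Finset.range (p - 1), RingOfIntegers.mapRingEquiv (σ ^ i) A) ∈ P := by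
    obtain ⟨c, hc⟩ := hdvd
    rw [prod_mapRingEquiv_eq_norm hζ hv hσ, hc, map_intCast]; push_cast
    exact P.mul_mem_right _ hqP
  rw [map_prod, Ideal.IsPrime.prod_mem_iff] at h1
  obtain ⟨k, _, hk⟩ := h1
  refine ⟨k, fun x hx => ?_⟩
  have h2 : x ^ n ∈ Ideal.span {A} := hA ▸ Ideal.pow_mem_pow hx n
  obtain ⟨c, hc⟩ := Ideal.mem_span_singleton.mp h2
  refine Ideal.IsPrime.mem_of_pow_mem inferInstance n ?_
  rw [← map_pow, ← map_pow, hc, map_mul, map_mul]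
  exact P.mul_mem_right _ hk

/-- `A ^ P(σ) / g ^ (n p)` is an algebraic integer. -/
theorem isIntegral_stickelberger_quotient [Fintype (𝓞 K ⧸ 𝔮)] (hp : 2 < p)
    (hζ : IsPrimitiveRoot ζ p) (hv : orderOf (v : ZMod p) = p - 1)
    (hσ : σ (ζ : K) = (ζ : K) ^ v) (hqp : q ≠ p) (h𝔮 : 𝔮 ≠ ⊥)
    {ρ : MulChar (𝓞 K ⧸ 𝔮) (𝓞 K)} (hρp : orderOf ρ = p)
    (hρ : ∀ x, x ≠ 0 → Ideal.Quotient.mk 𝔮 (ρ x) = x ^ ((Ideal.absNorm 𝔮 - 1) / p))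
    {A : 𝓞 K} {n : ℕ} (hA : Ideal.span {A} = 𝔮 ^ n) (hn : n ≠ 0) :
    IsIntegral ℤ (polyExp σ (stickP p v) (A : K) / (jacobiProduct ρ⁻¹ : 𝓞 K) ^ n) := by
  have : 𝔮.IsMaximal := Ideal.IsPrime.isMaximal inferInstance h𝔮
  let _ : Field (𝓞 K ⧸ 𝔮) := Ideal.Quotient.field 𝔮
  have hpri : p.Prime := Fact.out
  have hq : 1 < q := (Fact.out : q.Prime).one_lt
  have hodd : Odd p := hpri.odd_of_ne_two (by omega)
  have hρp' : orderOf ρ⁻¹ = p := by rw [orderOf_inv, hρp]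
  have hA0 : A ≠ 0 := by
    rintro rfl
    rw [Ideal.span_singleton_zero, eq_comm] at hA
    exact h𝔮 (eq_bot_iff.mpr fun x hx => by
      have : x ^ n ∈ (⊥ : Ideal (𝓞 K)) := hA ▸ Ideal.pow_mem_pow hx n
      simpa [hn] using this)
  have hcard : Ideal.absNorm 𝔮 = Fintype.card (𝓞 K ⧸ 𝔮) := by
    rw [Ideal.absNorm_apply, Submodule.cardQuot_apply, Nat.card_eq_fintype_card]
  have hm : 1 < Fintype.card (𝓞 K ⧸ 𝔮) := Fintype.one_lt_card
  -- a number field with the roots of unity that occur in the local computation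
  set N := q * (Ideal.absNorm 𝔮 - 1) with hN
  have hN0 : 0 < N := Nat.mul_pos (by omega) (by omega)
  have : NeZero N := ⟨hN0.ne'⟩
  let M := CyclotomicField N K
  have : NumberField M := IsCyclotomicExtension.numberField {N} K M
  obtain ⟨μ, hμ⟩ : ∃ μ : 𝓞 M, IsPrimitiveRoot μ N :=
    ⟨_, (IsCyclotomicExtension.zeta_spec N K M).toInteger_isPrimitiveRoot⟩
  have hξ : IsPrimitiveRoot (μ ^ (Ideal.absNorm 𝔮 - 1)) q := hμ.pow hN0 (by rw [hN, mul_comm])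
  have hη : IsPrimitiveRoot (μ ^ q) (Ideal.absNorm 𝔮 - 1) := hμ.pow hN0 hN
  let ι : 𝓞 K →+* 𝓞 M := RingOfIntegers.mapRingHom (algebraMap K M)
  have hι : Function.Injective ι := fun x y h => by
    apply RingOfIntegers.coe_injective
    exact (algebraMap K M).injective (congrArg (algebraMap (𝓞 M) M) h)
  have hG := gaussSum_ringHomComp_pow hι hρp' hodd hpri.two_le (traceChar_ne_one h𝔮 hξ)
  have hGinv := jacobiProduct_mul_inv hι hρp' hodd hpri.two_le (traceChar_ne_one h𝔮 hξ)
  set γ := jacobiProduct ρ⁻¹ with hγ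
  rw [← coe_prod_mapRingEquiv σ hA0]
  set B := ∏ i ∈ Finset.range (p - 1), RingOfIntegers.mapRingEquiv (σ ^ i) A ^
        ((v : ZMod p) ^ (-(i : ℤ))).val with hB
  have key : ∀ P : IsDedekindDomain.HeightOneSpectrum (𝓞 M),
      P.intValuation (ι B) ≤ P.intValuation (ι γ) ^ n := by
    intro P
    have := P.isPrime
    by_cases hqP : (q : 𝓞 M) ∈ P.asIdeal
    · obtain ⟨k, hk⟩ := exists_conjugate_mem (σ := σ) hζ hv hσ hqp h𝔮 hA hn ι hqP
      rw [← hG, map_pow]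
      exact valuation_prod_le_gaussSum_pow (w := P.intValuation) P.intValuation_le_one
        P.intValuation_lt_one_iff_mem hp hζ hv hσ hqp h𝔮 hk hη hξ hρp hρ hA
    · have h1 : P.intValuation (ι γ) = 1 := by
        refine le_antisymm (P.intValuation_le_one _) (not_lt.mp fun h => hqP ?_)
        rw [P.intValuation_lt_one_iff_mem] at h
        have h2 := P.asIdeal.mul_mem_right (ι (jacobiProduct ρ⁻¹⁻¹)) h
        rw [← map_mul, hGinv, map_pow, map_natCast, ← hcard,
          (absNorm_eq_pow_orderOf (q := q) hζ hqp h𝔮).1, Nat.cast_pow] at h2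
        exact Ideal.IsPrime.mem_of_pow_mem inferInstance _
          (Ideal.IsPrime.mem_of_pow_mem inferInstance _ h2)
      rw [h1, one_pow]
      exact P.intValuation_le_one _
  have hmem := IsDedekindDomain.HeightOneSpectrum.mem_integers_of_valuation_le_one (R := 𝓞 M) M
    (algebraMap (𝓞 M) M (ι B) / algebraMap (𝓞 M) M (ι γ) ^ n) (by
      intro P
      rw [map_div₀, map_pow, P.valuation_of_algebraMap, P.valuation_of_algebraMap]
      exact div_le_one_of_le₀ (key P) zero_le)
  obtain ⟨y, hy⟩ := hmem
  rw [← isIntegral_algebraMap_iff (B := M) (algebraMap K M).injective, map_div₀, map_pow]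
  have : IsIntegral ℤ (algebraMap (𝓞 M) M y) := y.isIntegral_coe
  rw [hy] at this
  exact this

end Global

/-! ### The two identities -/

section Conclusion

variable {p : ℕ} [Fact p.Prime] {K : Type*} [Field K] [NumberField K]
  [IsCyclotomicExtension {p} ℚ K] {ζ : 𝓞 K} {v : ℕ} {σ : K ≃+* K} {q : ℕ} [Fact q.Prime]
  {𝔮 : Ideal (𝓞 K)} [CharP (𝓞 K ⧸ 𝔮) q] [𝔮.IsPrime]

theorem ringHomComp_conj_eq_inv {F : Type*} [CommMonoid F] (hζ : IsPrimitiveRoot ζ p) (hp : 2 < p)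
    (hv : orderOf (v : ZMod p) = p - 1) (hσ : σ (ζ : K) = (ζ : K) ^ v) {χ : MulChar F (𝓞 K)}
    (hχ : orderOf χ = p) :
    χ.ringHomComp (RingOfIntegers.mapRingEquiv (σ ^ ((p - 1) / 2)) : 𝓞 K →+* 𝓞 K) = χ⁻¹ := by
  rw [eq_inv_iff_mul_eq_one]
  ext x
  have hx : χ x ^ p = 1 := by
    rw [← MulChar.pow_apply_coe, ← hχ, pow_orderOf_eq_one, MulChar.one_apply_coe]
  obtain ⟨e, _, he⟩ := hζ.eq_pow_of_pow_eq_one hx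
  rw [MulChar.mul_apply, MulChar.ringHomComp_apply, MulChar.one_apply_coe, ← he, map_pow,
    RingHom.coe_coe, mapRingEquiv_zeta hσ, ← pow_mul, ← pow_add, ← pow_zero ζ]
  congr 1
  apply zeta_pow_eq_of_zmod_eq hζ
  push_cast
  rw [pow_half_eq_neg_one p v hp hv]
  ring

/-- `A ^ P(σ) / g ^ (n p)` has absolute value `1` at every complex embedding. -/
theorem norm_stickelberger_quotient (hp : 2 < p)
    (hζ : IsPrimitiveRoot ζ p) (hv : orderOf (v : ZMod p) = p - 1)
    (hσ : σ (ζ : K) = (ζ : K) ^ v) {A γ : 𝓞 K} (hA0 : A ≠ 0) {m n : ℕ} (hm : m ≠ 0)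
    (hN : (Algebra.norm ℤ A).natAbs = m ^ n)
    (hγ : γ * RingOfIntegers.mapRingEquiv (σ ^ ((p - 1) / 2)) γ = (m : 𝓞 K) ^ p) (φ : K →+* ℂ) :
    ‖φ (polyExp σ (stickP p v) (A : K) / (γ : K) ^ n)‖ = 1 := by
  have hA0' : (A : K) ≠ 0 := RingOfIntegers.coe_ne_zero_iff.mpr hA0
  set H := polyExp σ (stickP p v) (A : K) / (γ : K) ^ n with hH
  set h := (p - 1) / 2 with hh
  have hγK : (γ : K) * (σ ^ h : K ≃+* K) (γ : K) = (m : K) ^ p := by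
    have := congrArg (algebraMap (𝓞 K) K) hγ
    simpa using this
  have hB0 := polyExp_ne_zero σ (stickP p v) hA0'
  have hB : polyExp σ (stickP p v) (A : K) * (σ ^ h : K ≃+* K) (polyExp σ (stickP p v) (A : K)) =
      ((Algebra.norm ℤ A : ℤ) : K) ^ p := by
    obtain ⟨R, hR⟩ := exists_stickP_add_half p v hp hv
    have h1 := congrArg (fun F => polyExp σ F (A : K)) hR
    rw [polyExp_mul σ _ _ hA0', polyExp_add σ _ _ hB0, polyExp_one σ hB0, polyExp_X_pow σ _ hB0,
      polyExp_add σ _ _ hA0', polyExp_X_pow_sub_one_mul σ (automorphism_pow_eq_one hζ hv hσ) _ hA0',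
      mul_one, polyExp_natCast_mul σ _ _ hA0', polyExp_sum σ _ _ hA0'] at h1
    rw [h1]
    congr 1
    have h2 := congrArg (algebraMap (𝓞 K) K) (prod_mapRingEquiv_eq_norm hζ hv hσ A)
    rw [map_intCast, map_prod] at h2
    rw [← h2]
    exact Finset.prod_congr rfl fun i _ => polyExp_X_pow σ i hA0'
  have hHH : H * (σ ^ h : K ≃+* K) H = ((Algebra.norm ℤ A : ℤ) : K) ^ p / (m : K) ^ (p * n) := by
    rw [hH, map_div₀, map_pow, div_mul_div_comm, ← mul_pow, hγK, hB, ← pow_mul]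
  have hconj : ‖φ ((σ ^ h : K ≃+* K) H)‖ = ‖φ H‖ := by
    rw [← conjK_eq hζ hp hv hσ]
    have : IsCMField K := IsCyclotomicExtension.Rat.isCMField K (S := {p}) ⟨p, rfl, hp⟩
    have h1 : φ (conjK K p hp H) = (starRingEnd ℂ) (φ H) :=
      IsCMField.complexEmbedding_complexConj K φ H
    rw [h1, Complex.norm_conj]
  have h1 := congrArg (fun x => ‖φ x‖) hHH
  simp only [map_mul, map_div₀, map_pow, map_intCast, map_natCast, norm_mul, norm_div, norm_pow,
    hconj, Complex.norm_natCast, Complex.norm_intCast] at h1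
  have h2 : |((Algebra.norm ℤ A : ℤ) : ℝ)| = (m : ℝ) ^ n := by
    rw [← Int.cast_abs, Int.abs_eq_natAbs, hN]; push_cast; rfl
  rw [h2, ← pow_mul, mul_comm n p, div_self (pow_ne_zero _ (Nat.cast_ne_zero.mpr hm))] at h1
  nlinarith [norm_nonneg (φ H)]

/-- A semi-primary root of unity is `1` or `-1`. -/
theorem eq_one_or_eq_neg_one_of_mem (hp : 2 < p) (hζ : IsPrimitiveRoot ζ p) {u : Kˣ}
    (hu : u ∈ semiPrimaryGroup p ζ) (hfin : IsOfFinOrder (u : K)) : u = 1 ∨ u = -1 := by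
  have hζK : IsPrimitiveRoot (ζ : K) p := hζ.map_of_injective RingOfIntegers.coe_injective
  have hodd : Odd p := (Fact.out : p.Prime).odd_of_ne_two (by omega)
  obtain ⟨r, _, h | h⟩ := hζK.exists_pow_or_neg_mul_pow_of_isOfFinOrder hodd hfin
  · left
    refine eq_one_of_pow_eq_one_of_mem hp hζ hu ?_
    ext
    rw [Units.val_pow_eq_pow_val, h, ← pow_mul, mul_comm, pow_mul, hζK.pow_eq_one, one_pow,
      Units.val_one]
  · right
    rw [← neg_eq_iff_eq_neg]
    have hu' : -u ∈ semiPrimaryGroup p ζ := by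
      rw [← neg_one_mul]
      exact mul_mem (neg_one_mem_semiPrimaryGroup p ζ) hu
    refine eq_one_of_pow_eq_one_of_mem hp hζ hu' ?_
    ext
    rw [Units.val_pow_eq_pow_val, Units.val_neg, h, neg_neg, ← pow_mul, mul_comm, pow_mul,
      hζK.pow_eq_one, one_pow, Units.val_one]

/-- The `p`-th power of the Gauss sum is a semi-primary integer `γ` of `K`, and `γ ^ n` is
`± A ^ P(σ)`. -/
theorem exists_gSum_pow_eq (hp : 2 < p)
    (hζ : IsPrimitiveRoot ζ p) (hv : orderOf (v : ZMod p) = p - 1)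
    (hσ : σ (ζ : K) = (ζ : K) ^ v) (hqp : q ≠ p) (h𝔮 : 𝔮 ≠ ⊥)
    {A : 𝓞 K} (hsemi : A ∈ semiPrimaryIntegers p ζ)
    {n : ℕ} (hA : Ideal.span {A} = 𝔮 ^ n) (hn : n ≠ 0) (hA0 : A ≠ 0)
    {L : Type*} [Field L] [Algebra K L] {ξ : L} (hξ : IsPrimitiveRoot ξ q) :
    ∃ γ ∈ semiPrimaryIntegers p ζ, γ ≠ 0 ∧ gSum p 𝔮 q ξ ^ p = algebraMap K L γ ∧
      (polyExp σ (stickP p v) (A : K) = (γ : K) ^ n ∨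
        polyExp σ (stickP p v) (A : K) = -(γ : K) ^ n) := by
  have : 𝔮.IsMaximal := Ideal.IsPrime.isMaximal inferInstance h𝔮
  let _ : Field (𝓞 K ⧸ 𝔮) := Ideal.Quotient.field 𝔮
  have : Finite (𝓞 K ⧸ 𝔮) := Ideal.finiteQuotientOfFreeOfNeBot 𝔮 h𝔮
  let _ : Fintype (𝓞 K ⧸ 𝔮) := Fintype.ofFinite _
  have hpri : p.Prime := Fact.out
  have hodd : Odd p := hpri.odd_of_ne_two (by omega)
  have hcard : Ideal.absNorm 𝔮 = Fintype.card (𝓞 K ⧸ 𝔮) := by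
    rw [Ideal.absNorm_apply, Submodule.cardQuot_apply, Nat.card_eq_fintype_card]
  have hm : Fintype.card (𝓞 K ⧸ 𝔮) ≠ 0 := Fintype.card_ne_zero
  obtain ⟨ρ, hρp, hρ, hρs⟩ := exists_residueChar (q := q) hζ hqp h𝔮
  have hρp' : orderOf ρ⁻¹ = p := by rw [orderOf_inv, hρp]
  let f : 𝓞 K →+* L := (algebraMap K L).comp (algebraMap (𝓞 K) K)
  have hf : Function.Injective f :=
    (algebraMap K L).injective.comp RingOfIntegers.coe_injective
  have hψ := traceChar_ne_one h𝔮 hξ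
  have hg : gSum p 𝔮 q ξ = gaussSum (ρ⁻¹.ringHomComp f) (traceChar 𝔮 q hξ.pow_eq_one) :=
    gSum_eq_sum h𝔮 hρs ξ
  have hgp := gaussSum_ringHomComp_pow hf hρp' hodd hpri.two_le hψ
  have hinv := jacobiProduct_mul_inv hf hρp' hodd hpri.two_le hψ
  have hconj := map_jacobiProduct
    (RingOfIntegers.mapRingEquiv (σ ^ ((p - 1) / 2)) : 𝓞 K →+* 𝓞 K)
    (ringHomComp_conj_eq_inv hζ hp hv hσ hρp') (by rw [orderOf_inv ρ⁻¹])
  have hint := isIntegral_stickelberger_quotient hp hζ hv hσ hqp h𝔮 hρp hρ hA hn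
  have hsp := jacobiProduct_mem_semiPrimaryIntegers hp hζ hρp'
    (hcard ▸ (absNorm_eq_pow_orderOf (q := q) hζ hqp h𝔮).2)
  rw [← hconj] at hinv
  set γ := jacobiProduct ρ⁻¹ with hγ
  have hγ0 : γ ≠ 0 := by
    intro h
    rw [h, zero_mul, eq_comm] at hinv
    exact (pow_ne_zero p (Nat.cast_ne_zero.mpr hm)) hinv
  refine ⟨γ, hsp, hγ0, by rw [hg, hgp]; rfl, ?_⟩
  have hA0' : (A : K) ≠ 0 := RingOfIntegers.coe_ne_zero_iff.mpr hA0
  have hγ0' : (γ : K) ≠ 0 := RingOfIntegers.coe_ne_zero_iff.mpr hγ0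
  have hB0 := polyExp_ne_zero σ (stickP p v) hA0'
  obtain ⟨N, hN, hN1⟩ := Embeddings.pow_eq_one_of_norm_eq_one K ℂ hint fun φ =>
    norm_stickelberger_quotient hp hζ hv hσ hA0 hm (hcard ▸ natAbs_norm_eq hA) hinv φ
  set uB := Units.mk0 _ hB0 with huB
  set uγ := Units.mk0 _ hγ0' with huγ
  have hBS : uB ∈ semiPrimaryGroup p ζ :=
    polyExp_mem σ (map_mem_semiPrimaryGroup hσ) (stickP p v)
      (mem_semiPrimaryGroup_of_integer (u := Units.mk0 _ hA0') hsemi rfl) rfl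
  have hγS : uγ ∈ semiPrimaryGroup p ζ := mem_semiPrimaryGroup_of_integer hsp rfl
  have hcoe : ((uB / uγ ^ n : Kˣ) : K) = polyExp σ (stickP p v) (A : K) / (γ : K) ^ n := by
    rw [Units.val_div_eq_div_val, Units.val_pow_eq_pow_val]; rfl
  rcases eq_one_or_eq_neg_one_of_mem hp hζ (div_mem hBS (pow_mem hγS n))
    (by rw [hcoe]; exact isOfFinOrder_iff_pow_eq_one.mpr ⟨N, hN, hN1⟩) with h | h
  · left
    rw [h, Units.val_one] at hcoe
    exact (div_eq_one_iff_eq (pow_ne_zero _ hγ0')).mp hcoe.symm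
  · right
    rw [h, Units.val_neg, Units.val_one, eq_comm, div_eq_iff (pow_ne_zero _ hγ0')] at hcoe
    rw [hcoe, neg_one_mul]

/-- If `γ ^ (2 p) = ± A ^ P(σ)` with `γ` and `A` semi-primary, then `γ ^ (2 (σ - 1)(σ - v))` equals
`(Ā / A) ^ Q₁(σ)`: the `p`-th powers of the two sides agree, and both sides are semi-primary. -/
theorem polyExp_eq_conj_div (hp : 2 < p)
    (hζ : IsPrimitiveRoot ζ p) (hv : orderOf (v : ZMod p) = p - 1)
    (hσ : σ (ζ : K) = (ζ : K) ^ v) {A γ : 𝓞 K} (hA : A ∈ semiPrimaryIntegers p ζ)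
    (hγ : γ ∈ semiPrimaryIntegers p ζ) (hA0 : A ≠ 0) (hγ0 : γ ≠ 0)
    (h : polyExp σ (stickP p v) (A : K) = (γ : K) ^ (2 * p) ∨
      polyExp σ (stickP p v) (A : K) = -(γ : K) ^ (2 * p)) :
    polyExp σ ((X - 1) * (X - (v : ℤ[X]))) ((γ : K) ^ 2) =
      polyExp σ (polyQ₁ p v) (conjK K p hp (A : K) / (A : K)) := by
  have hA0' : (A : K) ≠ 0 := RingOfIntegers.coe_ne_zero_iff.mpr hA0
  have hγ0' : (γ : K) ≠ 0 := RingOfIntegers.coe_ne_zero_iff.mpr hγ0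
  have hγ2 : (γ : K) ^ 2 ≠ 0 := pow_ne_zero _ hγ0'
  have hconj : conjK K p hp (A : K) / (A : K) = polyExp σ (X ^ ((p - 1) / 2) - 1) (A : K) := by
    rw [conjK_eq hζ hp hv hσ, polyExp_sub σ _ _ hA0', polyExp_X_pow σ _ hA0', polyExp_one σ hA0']
  set E : ℤ[X] := (X - 1) * (X - (v : ℤ[X])) with hE
  -- `σ - 1` kills the sign
  have hsign : ∀ x : K, x ≠ 0 → polyExp σ E (-x) = polyExp σ E x := by
    intro x hx
    have h1 : polyExp σ (X - 1) (-1 : K) = 1 := by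
      rw [polyExp_X_sub_one σ (neg_ne_zero.mpr one_ne_zero)]; simp
    rw [← neg_one_mul, polyExp_map_mul, hE, mul_comm (X - 1 : ℤ[X]),
      polyExp_mul σ _ _ (neg_ne_zero.mpr one_ne_zero), h1, polyExp_one_right, one_mul]
  have hpow : polyExp σ E ((γ : K) ^ 2) ^ p =
      polyExp σ (polyQ₁ p v) (polyExp σ (X ^ ((p - 1) / 2) - 1) (A : K)) ^ p := by
    have h1 : polyExp σ E (((γ : K) ^ 2) ^ p) = polyExp σ E (polyExp σ (stickP p v) (A : K)) := by
      rw [← pow_mul]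
      rcases h with h | h
      · rw [h]
      · rw [h, hsign _ (pow_ne_zero _ hγ0')]
    obtain ⟨R, hR⟩ := exists_stickP_eq p v hp hv
    rw [← polyExp_map_pow, h1, ← polyExp_mul σ _ _ hA0', hE, hR, polyExp_add σ _ _ hA0',
      polyExp_X_pow_sub_one_mul σ (automorphism_pow_eq_one hζ hv hσ) _ hA0', mul_one,
      polyExp_natCast_mul σ _ _ hA0', polyExp_mul σ _ _ hA0']
  rw [hconj]
  have hW0 := polyExp_ne_zero σ (X ^ ((p - 1) / 2) - 1) hA0'
  have hY0 := polyExp_ne_zero σ E hγ2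
  have hZ0 := polyExp_ne_zero σ (polyQ₁ p v) hW0
  have hS := map_mem_semiPrimaryGroup (p := p) hσ
  have hYS : Units.mk0 _ hY0 ∈ semiPrimaryGroup p ζ :=
    polyExp_mem σ hS E (mem_semiPrimaryGroup_of_integer (u := Units.mk0 _ hγ2) (pow_mem hγ 2)
      (by simp)) rfl
  have hWS : Units.mk0 _ hW0 ∈ semiPrimaryGroup p ζ :=
    polyExp_mem σ hS _ (mem_semiPrimaryGroup_of_integer (u := Units.mk0 _ hA0') hA rfl) rfl
  have hZS : Units.mk0 _ hZ0 ∈ semiPrimaryGroup p ζ := polyExp_mem σ hS (polyQ₁ p v) hWS rfl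
  have h1 := eq_one_of_pow_eq_one_of_mem hp hζ (div_mem hYS hZS) (by
    rw [div_pow, div_eq_one]
    ext
    exact hpow)
  exact congrArg Units.val (div_eq_one.mp h1)

end Conclusion

end GaussSingular

theorem theoremt601311
    -- the odd prime `p`, the `p`-cyclotomic field `K`, and `ζ = ζ_p`
    (p : ℕ) [Fact p.Prime] (hp : 2 < p)
    (K : Type*) [Field K] [NumberField K] [IsCyclotomicExtension {p} ℚ K]
    (ζ : 𝓞 K) (hζ : IsPrimitiveRoot ζ p)
    -- a primitive root `v` modulo `p` and the automorphism `σ : ζ ↦ ζ ^ v` of `K`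
    (v : ℕ) (hv : orderOf (v : ZMod p) = p - 1)
    (σ : K ≃+* K) (hσ : σ (ζ : K) = (ζ : K) ^ v)
    -- a component of the `p`-class group
    (r : ℕ) (Γ : Fin r → Subgroup (ClassGroup (𝓞 K)))
    (hΓ : GaussSingular.IsPClassDecomposition p σ Γ) (i : Fin r)
    -- a prime `𝔮` over the rational prime `q ≠ p`, with class in that component
    (q : ℕ) [Fact q.Prime] (hqp : q ≠ p)
    (𝔮 : Ideal (𝓞 K)) [𝔮.IsPrime] (h𝔮 : 𝔮 ≠ ⊥) [CharP (𝓞 K ⧸ 𝔮) q]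
    (hcl : ClassGroup.mk0 ⟨𝔮, mem_nonZeroDivisors_of_ne_zero h𝔮⟩ ∈ Γ i)
    -- a singular semi-primary integer `A` with `A ℤ[ζ] = 𝔮 ^ (2p)`
    (A : 𝓞 K) (hsing : GaussSingular.IsSingular p A) (hsemi : GaussSingular.IsSemiPrimary p ζ A)
    (hA : Ideal.span {A} = 𝔮 ^ (2 * p))
    -- the field `L = K(ξ)`, `ξ = ζ_q`, and the extension of `σ` to `L` that fixes `ξ`
    (L : Type*) [Field L] [Algebra K L] [IsCyclotomicExtension {q} K L]
    (ξ : L) (hξ : IsPrimitiveRoot ξ q)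
    (σL : L ≃+* L) (hσL : ∀ x : K, σL (algebraMap K L x) = algebraMap K L (σ x))
    (hσξ : σL ξ = ξ) :
    (GaussSingular.gSum p 𝔮 q ξ ^ (2 * p ^ 2)
        = algebraMap K L (GaussSingular.polyExp σ (GaussSingular.stickP p v) (A : K)) ∨
      GaussSingular.gSum p 𝔮 q ξ ^ (2 * p ^ 2)
        = -algebraMap K L (GaussSingular.polyExp σ (GaussSingular.stickP p v) (A : K))) ∧
    (GaussSingular.polyExp σL (2 * (p : ℤ[X]) * (X - 1) * (X - (v : ℤ[X])))
          (GaussSingular.gSum p 𝔮 q ξ)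
        = algebraMap K L (GaussSingular.polyExp σ (GaussSingular.polyQ₁ p v)
            (GaussSingular.conjK K p hp (A : K) / (A : K))) ∨
      GaussSingular.polyExp σL (2 * (p : ℤ[X]) * (X - 1) * (X - (v : ℤ[X])))
          (GaussSingular.gSum p 𝔮 q ξ)
        = -algebraMap K L (GaussSingular.polyExp σ (GaussSingular.polyQ₁ p v)
            (GaussSingular.conjK K p hp (A : K) / (A : K)))) := by
  have hp0 : p ≠ 0 := by omega
  have hsp := hsemi.mem_semiPrimaryIntegers
  have hA0 : A ≠ 0 := by
    rintro rfl
    rw [Ideal.span_singleton_zero, eq_comm, ← Ideal.zero_eq_bot,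
      pow_eq_zero_iff (mul_ne_zero two_ne_zero hp0)] at hA
    exact h𝔮 hA
  obtain ⟨γ, hγ, hγ0, hg, hAγ⟩ := GaussSingular.exists_gSum_pow_eq (σ := σ) hp hζ hv hσ hqp h𝔮 hsp hA
    (mul_ne_zero two_ne_zero hp0) hA0 hξ
  have hγ0' : (γ : K) ≠ 0 := RingOfIntegers.coe_ne_zero_iff.mpr hγ0
  have hg0 : GaussSingular.gSum p 𝔮 q ξ ≠ 0 := by
    intro h
    rw [h, zero_pow hp0, eq_comm, map_eq_zero_iff _ (algebraMap K L).injective] at hg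
    exact hγ0' hg
  refine ⟨?_, Or.inl ?_⟩
  · rw [show 2 * p ^ 2 = p * (2 * p) by ring, pow_mul, hg, ← map_pow]
    rcases hAγ with h | h
    · exact Or.inl (congrArg _ h.symm)
    · right
      rw [h, map_neg, neg_neg]
  · have hfac : 2 * (p : ℤ[X]) * (X - 1) * (X - (v : ℤ[X])) =
        ((X - 1) * (X - (v : ℤ[X]))) * ((2 * p : ℕ) : ℤ[X]) := by push_cast; ring
    rw [hfac, GaussSingular.polyExp_mul σL _ _ hg0, GaussSingular.polyExp_natCast σL _ hg0,
      mul_comm 2 p, pow_mul, hg, ← map_pow, GaussSingular.polyExp_algebraMap σ σL hσL,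
      GaussSingular.polyExp_eq_conj_div hp hζ hv hσ hsp hγ hA0 hγ0 hAγ]
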